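/- **Setting.** Let $\mathcal C\subset\mathbb R^n$ be a nonempty closed set with compact boundary, let $U\subseteq\mathbb R^m$ be a nonempty closed cone (not necessarily convex), and write $\mathbf d(x)=d(x,\mathcal C)$ for the Euclidean distance. Let $f:(\mathbb R^n\setminus\mathcal C)\times U\to\mathbb R^n$ satisfy: * **(Hl)** $f$ is continuous and, for all compact sets $\mathcal K\subset\mathbb R^n\setminus\mathcal C$ and $U_1\subset U$, there is $L>0$ with $|f(x,u)-f(y,u)|\le L|x-y|$ for all $x,y\in\mathcal K$ and $u\in U_1$. * **(Hg)(i)** $\nu:[0,+\infty)\to[0,+\infty)$ is a strictly increasing bijection such that $\bar f(x,u):=\dfrac{f(x,u)}{1+\nu(|u|)}$ is uniformly continuous on $\mathcal K\times U$ for every compact $\mathcal K\subset\mathbb R^n\setminus\mathcal C$, and bounded on $\{x\notin\mathcal C:\ \mathbf d(x)\le R\}\times U$ for every $R>0$. **Definitions.** For $g\in\{f,\bar f\}$, an *admissible trajectory-control pair* for $(g,U)$ is a pair $(x,u)$ for which there is $T_x\in(0,+\infty]$ with $u\in L^\infty_{loc}([0,T_x),U)$, $x\in AC_{loc}([0,T_x),\mathbb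 R^n\setminus\mathcal C)$, $\dot x(t)=g(x(t),u(t))$ for a.e. $t\in[0,T_x)$ and, if $T_x<+\infty$, $\lim_{t\to T_x^-}\mathbf d(x(t))=0$. If $T_x<+\infty$, $x$ is extended to $[0,+\infty)$ by setting $x(t):=\bar z$ for $t\ge T_x$, where $\bar z$ is any point of $\partial\mathcal C$ such that $x(\tau_i)\to\bar z$ for some sequence $\tau_i\uparrow T_x$. $\mathcal{KL}$ is the set of continuous functions $\beta:[0,+\infty)\times[0,+\infty)\to[0,+\infty)$ such that $\beta(0,t)=0$ and $\beta(\cdot,t)$ is strictly increasing and unbounded for each $t\ge0$; $\beta(r,\cdot)$ is strictly decreasing for each $r>0$; and $\beta(r,t)\to0$ as $t\to+\infty$ for each $r\ge0$. The system $\dot x=g(x,u)$, $u\in U$, is *GAC (globally asymptotically controllable) to $\mathcal C$* if there is $\beta\in\mathcal{KL}$ such that for every $z\in\mathbb R^n\setminus\mathcal C$ there is an admissible trajectory-control pair $(x,u)$ for $(g,U)$ with $x(0)=z$ and $\mathbf d(x(t))\le\beta(\mathbf d(z),t)$ for all $t\ge0$. It is *GAC to $\mathcal C$ with $U\cap\sigma$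 controls* if there are a continuous function $\sigma:(0,+\infty)\to(0,+\infty)$ and $\beta\in\mathcal{KL}$ such that for every $z\in\mathbb R^n\setminus\mathcal C$ there is an admissible trajectory-control pair $(x,u)$ for $(g,U)$ with $x(0)=z$, $\mathbf d(x(t))\le\beta(\mathbf d(z),t)$ for all $t\ge0$, and $|u(t)|\le\sigma(\mathbf d(x(t)))$ for a.e. $t\in[0,T_x)$. **Theorem.** The original system $\dot x=f(x,u)$, $u\in U$, is GAC to $\mathcal C$ if and only if the rescaled system $y'=\bar f(y,v)$, $v\in U$, is GAC to $\mathcal C$. In addition, each of these two systems is GAC to $\mathcal C$ if and only if it is GAC to $\mathcal C$ with $U\cap\sigma$ controls. -/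

import Mathlib

open Set Filter Topology MeasureTheory

noncomputable section

namespace ControlGAC

/-- The Euclidean space `ℝᵏ`. -/
abbrev Euc (k : ℕ) : Type := EuclideanSpace ℝ (Fin k)

/-- `U ⊆ ℝᵐ` is a (nonempty) closed cone; convexity is not required. -/
structure IsClosedCone {m : ℕ} (U : Set (Euc m)) : Prop where
  nonempty : U.Nonempty
  isClosed : IsClosed U
  smul_mem : ∀ u ∈ U, ∀ c : ℝ, 0 < c → c • u ∈ U

/-- The time interval `[0, T)`, where `T` may be `+∞`. -/
def timeDomain (T : EReal) : Set ℝ := {t | 0 ≤ t ∧ (t : EReal) < T}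

/-- The points of `∂C` that are limits of `x` along some sequence of times increasing
strictly to `T`. -/
def terminalPoints {n : ℕ} (C : Set (Euc n)) (x : ℝ → Euc n) (T : ℝ) : Set (Euc n) :=
  {ζ | ζ ∈ frontier C ∧ ∃ τ : ℕ → ℝ, StrictMono τ ∧ (∀ i, 0 ≤ τ i ∧ τ i < T) ∧
    Tendsto τ atTop (𝓝 T) ∧ Tendsto (fun i => x (τ i)) atTop (𝓝 ζ)}

/-- `(x, u)` is an admissible trajectory-control pair of `ẋ = f(x, u)`, `u ∈ U`, with target
`C` and final time `T ∈ (0, +∞]`. The trajectory is given together with its extension to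
`[0, +∞)`: if `T < +∞`, then `x` is constant on `[T, +∞)`, equal to a terminal point.
The values of `u` outside `[0, T)`, and of `x` at negative times, are irrelevant. -/
structure IsAdmissiblePair {n m : ℕ} (f : Euc n → Euc m → Euc n) (C : Set (Euc n))
    (U : Set (Euc m)) (T : EReal) (x : ℝ → Euc n) (u : ℝ → Euc m) : Prop where
  pos : 0 < T
  control_mem : ∀ t ∈ timeDomain T, u t ∈ U
  control_bdd : ∀ b ∈ timeDomain T, MemLp u ⊤ (volume.restrict (Icc 0 b))
  traj_mem : ∀ t ∈ timeDomain T, x t ∉ C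
  traj_ac : ∀ b ∈ timeDomain T, AbsolutelyContinuousOnInterval x 0 b
  ode : ∀ᵐ t ∂(volume.restrict (timeDomain T)), HasDerivAt x (f (x t) (u t)) t
  terminal : ∀ S : ℝ, T = (S : EReal) →
    Tendsto (fun t => Metric.infDist (x t) C) (𝓝[<] S) (𝓝 0) ∧
      ∃ ζ ∈ terminalPoints C x S, ∀ t : ℝ, S ≤ t → x t = ζ

/-- Descent rates: `β : [0, +∞) × [0, +∞) → [0, +∞)` of class `𝒦ℒ`. -/
structure IsKL (β : ℝ → ℝ → ℝ) : Prop where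
  nonneg : ∀ r t : ℝ, 0 ≤ r → 0 ≤ t → 0 ≤ β r t
  continuousOn : ContinuousOn (fun p : ℝ × ℝ => β p.1 p.2) (Ici 0 ×ˢ Ici 0)
  zero : ∀ t : ℝ, 0 ≤ t → β 0 t = 0
  strictMonoOn : ∀ t : ℝ, 0 ≤ t → StrictMonoOn (fun r => β r t) (Ici 0)
  unbounded : ∀ t : ℝ, 0 ≤ t → ¬ BddAbove ((fun r => β r t) '' Ici 0)
  strictAntiOn : ∀ r : ℝ, 0 < r → StrictAntiOn (β r) (Ici 0)
  tendsto_zero : ∀ r : ℝ, 0 ≤ r → Tendsto (β r) atTop (𝓝 0)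

/-- The system `ẋ = f(x, u)`, `u ∈ U`, is globally asymptotically controllable to `C`. -/
def IsGAC {n m : ℕ} (f : Euc n → Euc m → Euc n) (C : Set (Euc n)) (U : Set (Euc m)) : Prop :=
  ∃ β : ℝ → ℝ → ℝ, IsKL β ∧ ∀ z : Euc n, z ∉ C →
    ∃ (T : EReal) (x : ℝ → Euc n) (u : ℝ → Euc m), IsAdmissiblePair f C U T x u ∧ x 0 = z ∧
      ∀ t : ℝ, 0 ≤ t → Metric.infDist (x t) C ≤ β (Metric.infDist z C) t

/-- The system `ẋ = f(x, u)`, `u ∈ U`, is globally asymptotically controllable to `C` with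
`U ∩ σ` controls, for the given function `σ`. -/
def IsGACWith {n m : ℕ} (f : Euc n → Euc m → Euc n) (C : Set (Euc n)) (U : Set (Euc m))
    (σ : ℝ → ℝ) : Prop :=
  ∃ β : ℝ → ℝ → ℝ, IsKL β ∧ ∀ z : Euc n, z ∉ C →
    ∃ (T : EReal) (x : ℝ → Euc n) (u : ℝ → Euc m), IsAdmissiblePair f C U T x u ∧ x 0 = z ∧
      (∀ t : ℝ, 0 ≤ t → Metric.infDist (x t) C ≤ β (Metric.infDist z C) t) ∧
      ∀ᵐ t ∂(volume.restrict (timeDomain T)), ‖u t‖ ≤ σ (Metric.infDist (x t) C)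

/-- Globally asymptotically controllable to `C` with `U ∩ σ` controls, for some continuous
`σ : (0, +∞) → (0, +∞)`. -/
def IsGACSigma {n m : ℕ} (f : Euc n → Euc m → Euc n) (C : Set (Euc n)) (U : Set (Euc m)) :
    Prop :=
  ∃ σ : ℝ → ℝ, ContinuousOn σ (Ioi 0) ∧ (∀ r : ℝ, 0 < r → 0 < σ r) ∧ IsGACWith f C U σ

/-- `f` is continuous on `(ℝⁿ ∖ C) × U` and, on compact sets, Lipschitz in the state
uniformly in the control. -/
structure LocallyLipschitzInState {n m : ℕ} (f : Euc n → Euc m → Euc n) (C : Set (Euc n))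
    (U : Set (Euc m)) : Prop where
  continuousOn : ContinuousOn (fun p : Euc n × Euc m => f p.1 p.2) (Cᶜ ×ˢ U)
  lipschitz : ∀ (K : Set (Euc n)) (U₁ : Set (Euc m)), IsCompact K → K ⊆ Cᶜ →
    IsCompact U₁ → U₁ ⊆ U →
    ∃ L : ℝ, 0 < L ∧ ∀ x ∈ K, ∀ y ∈ K, ∀ u ∈ U₁, ‖f x u - f y u‖ ≤ L * ‖x - y‖

/-- Growth rates: strictly increasing bijections of `[0, +∞)`. -/
structure IsGrowthRate (ν : ℝ → ℝ) : Prop where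
  strictMonoOn : StrictMonoOn ν (Ici 0)
  bijOn : BijOn ν (Ici 0) (Ici 0)

/-- The rescaled dynamics `f̄(x, u) = f(x, u) / (1 + ν(|u|))`. -/
def rescaled {n m : ℕ} (ν : ℝ → ℝ) (f : Euc n → Euc m → Euc n) : Euc n → Euc m → Euc n :=
  fun x u => (1 + ν ‖u‖)⁻¹ • f x u

/-- The growth condition of `f` relative to the growth rate `ν`. -/
structure HasGrowth {n m : ℕ} (ν : ℝ → ℝ) (f : Euc n → Euc m → Euc n) (C : Set (Euc n))
    (U : Set (Euc m)) : Prop where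
  uniformContinuousOn : ∀ K : Set (Euc n), IsCompact K → K ⊆ Cᶜ →
    UniformContinuousOn (fun p : Euc n × Euc m => rescaled ν f p.1 p.2) (K ×ˢ U)
  bounded : ∀ R : ℝ, 0 < R → ∃ M : ℝ, ∀ x : Euc n, x ∉ C → Metric.infDist x C ≤ R →
    ∀ u ∈ U, ‖rescaled ν f x u‖ ≤ M

end ControlGAC

end

/-! Everything passes through one property, `HasDescent`: from each dyadic shell `2 ^ k < d ≤ 2 ^ (k
+ 1)` around `C` the level `2 ^ k` can be reached with duration at most `T k`, controls bounded by
`M k` and distance at most `b k` on the way, where `b` is monotone and vanishes at `-∞`.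

GAC gives descent (`IsGAC.hasDescent`): the `𝒦ℒ` bound yields a common time for the whole shell, and
by continuous dependence (`IsArc.exists_perturbation`) the control chosen for one state also serves
its neighbours. Since `∂C` is compact, so is the closed shell; finitely many controls suffice,
whence a common `M k`.

Descent gives GAC with `U ∩ σ` controls (`HasDescent.isGACSigma`): descents through successive
shells are concatenated. Phase `k` only visits distances in `[2 ^ k, b k]`, and a given distance
lies in finitely many such intervals, so a continuous `σ` dominates every relevant `M k`. Durations
and overshoots are absorbed into one `𝒦ℒ` function.

Finally, descent does not see the rescaling. On controls bounded by `M k` the factor `1 + ν(|u|)`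
lies between `1` and `1 + ν (M k)`, so a change of time turns descents of one system into descents
of the other along the same paths (`hasDescent_rescaled_iff`). -/

noncomputable section

namespace ControlGAC

/-! ### Lipschitz curves and primitives -/

section Lipschitz

variable {E : Type*} [NormedAddCommGroup E] [NormedSpace ℝ E]

omit [NormedSpace ℝ E] in
/-- A bounded measurable function is interval integrable. -/
theorem intervalIntegrable_of_bounded [SecondCountableTopology E] [MeasurableSpace E] [BorelSpace E]
    {h : ℝ → E} (hm : Measurable h) {K : ℝ} (hK : ∀ t, ‖h t‖ ≤ K) (a b : ℝ) :
    IntervalIntegrable h volume a b := by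
  refine (intervalIntegrable_const (c := K)).mono_fun hm.aestronglyMeasurable ?_
  filter_upwards with t
  exact (hK t).trans (le_abs_self K)

/-- The primitive of a bounded measurable function is Lipschitz. -/
theorem lipschitzWith_integral [SecondCountableTopology E] [MeasurableSpace E] [BorelSpace E]
    {h : ℝ → E} (hm : Measurable h) {K : ℝ} (hK0 : 0 ≤ K) (hK : ∀ t, ‖h t‖ ≤ K) :
    LipschitzWith K.toNNReal (fun t => ∫ s in (0 : ℝ)..t, h s) := by
  refine LipschitzWith.of_dist_le_mul fun s t => ?_
  rw [dist_eq_norm, intervalIntegral.integral_interval_sub_left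
    (intervalIntegrable_of_bounded hm hK _ _) (intervalIntegrable_of_bounded hm hK _ _),
    Real.coe_toNNReal _ hK0, Real.dist_eq]
  exact intervalIntegral.norm_integral_le_of_norm_le_const fun x _ => hK x

theorem ae_hasDerivAt_integral_of_bounded [CompleteSpace E] [SecondCountableTopology E]
    [MeasurableSpace E] [BorelSpace E]
    {h : ℝ → E} (hm : Measurable h) {K : ℝ} (hK : ∀ t, ‖h t‖ ≤ K) :
    ∀ᵐ t, HasDerivAt (fun t => ∫ s in (0 : ℝ)..t, h s) (h t) t := by
  have hloc : LocallyIntegrable h volume := by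
    refine (locallyIntegrable_const K).mono hm.aestronglyMeasurable ?_
    filter_upwards with t
    exact (hK t).trans (le_abs_self K)
  filter_upwards [LocallyIntegrable.ae_hasDerivAt_integral hloc] with t ht using ht 0

/-- An absolutely continuous function with an almost everywhere bounded derivative is
Lipschitz. -/
theorem lipschitzOnWith_of_ae_hasDerivAt_le [CompleteSpace E] [SecondCountableTopology E]
    {x h : ℝ → E} {b K : ℝ} (hb : 0 ≤ b) (hK : 0 ≤ K)
    (hx : AbsolutelyContinuousOnInterval x 0 b)
    (hd : ∀ᵐ t, t ∈ Icc 0 b → HasDerivAt x (h t) t ∧ ‖h t‖ ≤ K) :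
    LipschitzOnWith K.toNNReal x (Icc 0 b) := by
  borelize E
  -- `h` need not be measurable, so the bounded integrand is a truncation of `deriv x`, which agrees
  -- with `h` almost everywhere on the interval.
  set S : Set ℝ := {t | ‖deriv x t‖ ≤ K} with hS
  have hSm : MeasurableSet S := measurableSet_le (measurable_deriv x).norm measurable_const
  set p : ℝ → E := S.indicator (deriv x) with hp
  have hpm : Measurable p := (measurable_deriv x).indicator hSm
  have hpK : ∀ t, ‖p t‖ ≤ K := by
    intro t
    by_cases ht : t ∈ S
    · rw [hp, indicator_of_mem ht]
      exact ht
    · simpa [hp, ht] using hK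
  have hFL := lipschitzWith_integral hpm hK hpK
  have hAC : AbsolutelyContinuousOnInterval (x - fun t => ∫ s in (0 : ℝ)..t, p s) 0 b :=
    hx.sub (hFL.lipschitzOnWith.absolutelyContinuousOnInterval)
  obtain ⟨c, hc⟩ := hAC.const_of_ae_hasDerivAt_zero (by
    filter_upwards [hd, ae_hasDerivAt_integral_of_bounded hpm hpK] with t h1 h2 ht
    rw [uIcc_of_le hb] at ht
    obtain ⟨h3, h4⟩ := h1 ht
    have : p t = h t := by
      have : t ∈ S := (congrArg norm h3.deriv).trans_le h4
      simp [hp, this, h3.deriv]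
    rw [this] at h2
    simpa using h3.sub h2)
  rw [uIcc_of_le hb] at hc
  refine LipschitzOnWith.of_dist_le_mul fun s hs t ht => ?_
  have e1 := hc s hs
  have e2 := hc t ht
  simp only [Pi.sub_apply, sub_eq_iff_eq_add] at e1 e2
  rw [e1, e2, dist_add_left]
  exact hFL.dist_le_mul s t

end Lipschitz

/-- Lipschitz functions on adjacent intervals glue to a Lipschitz function. -/
theorem exists_lipschitzOnWith_Icc_union {E : Type*} [PseudoMetricSpace E] {x : ℝ → E} {a b c : ℝ}
    (h1 : ∃ K, LipschitzOnWith K x (Icc a b)) (h2 : ∃ K, LipschitzOnWith K x (Icc b c)) :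
    ∃ K, LipschitzOnWith K x (Icc a c) := by
  obtain ⟨K₁, h1⟩ := h1
  obtain ⟨K₂, h2⟩ := h2
  refine ⟨max K₁ K₂, ?_⟩
  have h1' := h1.weaken (le_max_left K₁ K₂)
  have h2' := h2.weaken (le_max_right K₁ K₂)
  have key : ∀ s ∈ Icc a c, ∀ t ∈ Icc a c, s ≤ t →
      dist (x s) (x t) ≤ (max K₁ K₂ : NNReal) * dist s t := by
    intro s hs t ht hst
    rcases le_total t b with htb | htb
    · exact h1'.dist_le_mul s ⟨hs.1, hst.trans htb⟩ t ⟨ht.1, htb⟩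
    rcases le_total s b with hsb | hsb
    · have e1 := h1'.dist_le_mul s ⟨hs.1, hsb⟩ b ⟨hs.1.trans hsb, le_rfl⟩
      have e2 := h2'.dist_le_mul b ⟨le_rfl, htb.trans ht.2⟩ t ⟨htb, ht.2⟩
      have e3 : dist s t = dist s b + dist b t := by
        rw [Real.dist_eq, Real.dist_eq, Real.dist_eq, abs_of_nonpos (by linarith),
          abs_of_nonpos (by linarith), abs_of_nonpos (by linarith)]
        ring
      rw [e3, mul_add]
      exact (dist_triangle _ _ _).trans (add_le_add e1 e2)
    · exact h2'.dist_le_mul s ⟨hsb, hs.2⟩ t ⟨htb, ht.2⟩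
  refine LipschitzOnWith.of_dist_le_mul fun s hs t ht => ?_
  rcases le_total s t with h | h
  · exact key s hs t ht h
  · rw [dist_comm, dist_comm s t]
    exact key t ht s hs h

/-! ### Comparison functions and continuous majorants -/

section Majorants

/-- Comparison functions of class `𝒦_∞`. -/
structure IsKInf (α : ℝ → ℝ) : Prop where
  continuousOn : ContinuousOn α (Ici 0)
  zero : α 0 = 0
  strictMonoOn : StrictMonoOn α (Ici 0)
  le_self : ∀ r, 0 ≤ r → r ≤ α r

theorem IsKInf.nonneg {α : ℝ → ℝ} (h : IsKInf α) {r : ℝ} (hr : 0 ≤ r) : 0 ≤ α r :=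
  hr.trans (h.le_self r hr)

/-- A monotone function vanishing continuously at `0` has a majorant of class `𝒦_∞`. -/
theorem exists_isKInf_ge {h : ℝ → ℝ} (hm : Monotone h) (h0 : h 0 = 0)
    (hc : Tendsto h (𝓝[>] 0) (𝓝 0)) : ∃ α, IsKInf α ∧ ∀ r, 0 ≤ r → h r ≤ α r := by
  have hint : ∀ a b, IntervalIntegrable h volume a b := fun a b => hm.intervalIntegrable
  have hcint : ∀ r : ℝ, 0 ≤ r → IntervalIntegrable (fun s => h (r * s)) volume 1 2 := by
    intro r hr
    exact Monotone.intervalIntegrable fun s t hst => hm (mul_le_mul_of_nonneg_left hst hr)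
  -- The mean of `h` over `[r, 2r]`: continuous even where `h` jumps, and squeezed between `h r` and
  -- `h (2 * r)`.
  set A : ℝ → ℝ := fun r => ∫ s in (1 : ℝ)..2, h (r * s) with hA
  have hlow : ∀ r, 0 ≤ r → h r ≤ A r := by
    intro r hr
    have : ∫ s in (1 : ℝ)..2, h r ≤ A r := by
      refine intervalIntegral.integral_mono_on (by norm_num) (by simp) (hcint r hr) ?_
      intro s hs
      exact hm (le_mul_of_one_le_right hr hs.1)
    have e : ∫ s in (1 : ℝ)..2, h r = h r := by
      rw [intervalIntegral.integral_const]; norm_num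
    linarith
  have hup : ∀ r, 0 ≤ r → A r ≤ h (2 * r) := by
    intro r hr
    have : A r ≤ ∫ s in (1 : ℝ)..2, h (2 * r) := by
      refine intervalIntegral.integral_mono_on (by norm_num) (hcint r hr) (by simp) ?_
      intro s hs
      exact hm (by nlinarith [hs.2])
    have e : ∫ s in (1 : ℝ)..2, h (2 * r) = h (2 * r) := by
      rw [intervalIntegral.integral_const]; norm_num
    linarith
  have hmono : MonotoneOn A (Ici 0) := by
    intro r hr s hs hrs
    refine intervalIntegral.integral_mono_on (by norm_num) (hcint r hr) (hcint s hs) ?_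
    intro t ht
    exact hm (mul_le_mul_of_nonneg_right hrs (by linarith [ht.1]))
  have hA0 : A 0 = 0 := by simp [hA, h0]
  have hcont : ContinuousOn A (Ici 0) := by
    intro r hr
    rcases eq_or_lt_of_le (show (0 : ℝ) ≤ r from hr) with h0r | hr0
    · subst h0r
      rw [ContinuousWithinAt, hA0]
      have hc' : Tendsto h (𝓝[≥] 0) (𝓝 0) := by
        rw [← Ioi_insert, nhdsWithin_insert, tendsto_sup]
        refine ⟨?_, hc⟩
        rw [tendsto_pure_left]
        intro s hs
        rw [h0]
        exact mem_of_mem_nhds hs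
      have h2 : Tendsto (fun r : ℝ => 2 * r) (𝓝[≥] 0) (𝓝[≥] 0) := by
        refine tendsto_nhdsWithin_iff.2 ⟨?_, ?_⟩
        · have : Tendsto (fun r : ℝ => 2 * r) (𝓝 0) (𝓝 (2 * 0)) := by
            exact (continuous_const.mul continuous_id).tendsto 0
          rw [mul_zero] at this
          exact this.mono_left nhdsWithin_le_nhds
        · filter_upwards [self_mem_nhdsWithin] with r hr
          simpa using hr
      refine tendsto_of_tendsto_of_tendsto_of_le_of_le' tendsto_const_nhds (hc'.comp h2) ?_ ?_
      · filter_upwards [self_mem_nhdsWithin] with r hr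
        exact (h0.symm.le.trans (hm hr)).trans (hlow r hr)
      · filter_upwards [self_mem_nhdsWithin] with r hr using hup r hr
    · have hprim : Continuous fun t => ∫ s in (0 : ℝ)..t, h s :=
        intervalIntegral.continuous_primitive hint 0
      have hcA : ContinuousAt (fun r : ℝ => r⁻¹ * ((∫ s in (0 : ℝ)..(r * 2), h s) -
          ∫ s in (0 : ℝ)..(r * 1), h s)) r := by
        refine (continuousAt_inv₀ hr0.ne').mul ?_
        exact ((hprim.comp (continuous_id.mul continuous_const)).sub
          (hprim.comp (continuous_id.mul continuous_const))).continuousAt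
      refine (hcA.congr ?_).continuousWithinAt
      filter_upwards [lt_mem_nhds hr0] with s hs
      change _ = ∫ t in (1 : ℝ)..2, h (s * t)
      rw [intervalIntegral.integral_interval_sub_left (hint _ _) (hint _ _),
        intervalIntegral.integral_comp_mul_left _ hs.ne', smul_eq_mul]
  -- The summand `r` provides strict monotonicity and the bound `r ≤ α r`.
  refine ⟨fun r => r + A r, ⟨continuousOn_id.add hcont, by simp [hA0], ?_, ?_⟩, ?_⟩
  · intro r hr s hs hrs
    exact add_lt_add_of_lt_of_le hrs (hmono hr hs hrs.le)
  · intro r hr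
    have := (h0.symm.le.trans (hm hr)).trans (hlow r hr)
    simpa using this
  · intro r hr
    have := hlow r hr
    show h r ≤ r + A r
    linarith

/-- A two-sided sequence of points with prescribed monotone lower bounds, vanishing at `-∞`,
has a majorant of class `𝒦_∞`. -/
theorem exists_isKInf_ge_seq {a c : ℤ → ℝ} (ha : StrictMono a) (ha0 : ∀ i, 0 < a i)
    (hat : Tendsto a atTop atTop) (hc : Monotone c) (hc0 : ∀ i, 0 ≤ c i)
    (hcb : Tendsto c atBot (𝓝 0)) : ∃ α, IsKInf α ∧ ∀ i, c i ≤ α (a i) := by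
  classical
  -- The step function through the prescribed values; the supremum is finite because `a` tends to
  -- `+∞` and `c` is monotone.
  set h : ℝ → ℝ := fun r => ⨆ i, if a i ≤ r then c i else 0 with hh
  have hbdd : ∀ r, BddAbove (range fun i => if a i ≤ r then c i else 0) := by
    intro r
    obtain ⟨N, hN⟩ := (hat.eventually_gt_atTop r).exists
    refine ⟨c N, ?_⟩
    rintro _ ⟨i, rfl⟩
    dsimp only
    split_ifs with hi
    · exact hc (ha.lt_iff_lt.1 (hi.trans_lt hN)).le
    · exact hc0 N
  have hnn : ∀ r, 0 ≤ h r := by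
    intro r
    refine Real.iSup_nonneg fun i => ?_
    split_ifs
    · exact hc0 i
    · exact le_rfl
  have hmono : Monotone h := by
    intro r s hrs
    refine ciSup_mono (hbdd s) fun i => ?_
    split_ifs with h1 h2
    · exact le_rfl
    · exact absurd (h1.trans hrs) h2
    · exact hc0 i
    · exact le_rfl
  have h0 : h 0 = 0 := by
    have : ∀ i, ¬ a i ≤ 0 := fun i => not_le.2 (ha0 i)
    simp [hh, this]
  have hlim : Tendsto h (𝓝[>] 0) (𝓝 0) := by
    refine Metric.tendsto_nhds.2 fun ε hε => ?_
    obtain ⟨i₀, hi₀⟩ := ((hcb.eventually (gt_mem_nhds (half_pos hε)))).exists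
    filter_upwards [Ioo_mem_nhdsGT (ha0 i₀)] with r hr
    rw [Real.dist_eq, sub_zero, abs_of_nonneg (hnn r)]
    refine lt_of_le_of_lt (ciSup_le (c := ε / 2) fun i => ?_) (half_lt_self hε)
    split_ifs with h1
    · exact (hc (ha.lt_iff_lt.1 (h1.trans_lt hr.2)).le).trans hi₀.le
    · exact (half_pos hε).le
  obtain ⟨α, hα, hge⟩ := exists_isKInf_ge hmono h0 hlim
  refine ⟨α, hα, fun i => ?_⟩
  refine le_trans ?_ (hge (a i) (ha0 i).le)
  have := le_ciSup (hbdd (a i)) i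
  simpa using this

/-- Class `𝒦ℒ` functions in factored form. -/
theorem isKL_of_isKInf {α γ : ℝ → ℝ} (hα : IsKInf α) (hγ : IsKInf γ) :
    IsKL (fun r t => α (γ r * Real.exp (-t))) := by
  have hnn : ∀ r t : ℝ, 0 ≤ r → 0 ≤ γ r * Real.exp (-t) := fun r t hr =>
    mul_nonneg (hγ.nonneg hr) (Real.exp_pos _).le
  refine ⟨fun r t hr _ => hα.nonneg (hnn r t hr), ?_, fun t _ => by simp [hγ.zero, hα.zero], ?_,
    ?_, ?_, ?_⟩
  · refine hα.continuousOn.comp (t := Ici 0) ?_ ?_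
    · refine ContinuousOn.mul ?_ ?_
      · exact hγ.continuousOn.comp continuousOn_fst fun p hp => hp.1
      · exact (Real.continuous_exp.comp continuous_snd.neg).continuousOn
    · exact fun p hp => hnn _ _ hp.1
  · intro t _ r hr s hs hrs
    exact hα.strictMonoOn (hnn r t hr) (hnn s t hs)
      (mul_lt_mul_of_pos_right (hγ.strictMonoOn hr hs hrs) (Real.exp_pos _))
  · rintro t _ ⟨B, hB⟩
    set r := (|B| + 1) * Real.exp t with hr
    have hr0 : 0 ≤ r := by positivity
    have h1 := hB ⟨r, hr0, rfl⟩
    have h2 := hα.le_self _ (hnn r t hr0)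
    have h3 : r * Real.exp (-t) ≤ γ r * Real.exp (-t) :=
      mul_le_mul_of_nonneg_right (hγ.le_self r hr0) (Real.exp_pos _).le
    have h4 : r * Real.exp (-t) = |B| + 1 := by
      rw [hr, mul_assoc, ← Real.exp_add]; simp
    have := le_abs_self B
    dsimp only at h1
    linarith
  · intro r hr s _ t _ hst
    refine hα.strictMonoOn (hnn r t hr.le) (hnn r s hr.le) ?_
    refine mul_lt_mul_of_pos_left (Real.exp_lt_exp.2 (by linarith)) ?_
    exact hr.trans_le (hγ.le_self r hr.le)
  · intro r hr
    have h1 : Tendsto (fun t => γ r * Real.exp (-t)) atTop (𝓝[≥] 0) := by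
      refine tendsto_nhdsWithin_iff.2 ⟨?_, Eventually.of_forall fun t => hnn r t hr⟩
      simpa using (Real.tendsto_exp_neg_atTop_nhds_zero).const_mul (γ r)
    have h2 := hα.continuousOn 0 (mem_Ici.2 le_rfl)
    rw [ContinuousWithinAt, hα.zero] at h2
    exact h2.comp h1

/-- A continuous positive function dominating `M k` on each interval `[2 ^ k, b k]`. -/
theorem exists_continuousOn_ge_of_Icc {b M : ℤ → ℝ} (hb : Tendsto b atBot (𝓝 0)) :
    ∃ σ : ℝ → ℝ, ContinuousOn σ (Ioi 0) ∧ (∀ r : ℝ, 0 < r → 0 < σ r) ∧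
      ∀ (k : ℤ) (r : ℝ), (2 : ℝ) ^ k ≤ r → r ≤ b k → M k ≤ σ r := by
  -- A partition of unity in the variable `s = log r`: the constraints are convex, and near each `s`
  -- a constant satisfies them all. Indeed `2 ^ k ≤ exp s` bounds the active `k` above, and `exp s ≤
  -- b k` with `b → 0` bounds them below.
  obtain ⟨g, hg⟩ := exists_continuous_forall_mem_convex_of_local_const (X := ℝ) (E := ℝ)
    (t := fun s => {y | 0 < y ∧ ∀ k : ℤ, (2 : ℝ) ^ k ≤ Real.exp s → Real.exp s ≤ b k → M k ≤ y})
    (by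
      intro s
      have : {y | 0 < y ∧ ∀ k : ℤ, (2 : ℝ) ^ k ≤ Real.exp s → Real.exp s ≤ b k → M k ≤ y} =
          Ioi 0 ∩ ⋂ (k : ℤ) (_ : (2 : ℝ) ^ k ≤ Real.exp s) (_ : Real.exp s ≤ b k), Ici (M k) := by
        ext y; simp
      rw [this]
      exact (convex_Ioi 0).inter (convex_iInter fun _ => convex_iInter fun _ =>
        convex_iInter fun _ => convex_Ici _))
    (by
      intro s
      obtain ⟨K₁, hK₁⟩ : ∃ K : ℤ, Real.exp (s + 1) < (2 : ℝ) ^ K := by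
        obtain ⟨K, hK⟩ := pow_unbounded_of_one_lt (Real.exp (s + 1)) (one_lt_two (α := ℝ))
        exact ⟨K, by simpa using hK⟩
      obtain ⟨K₀, hK₀⟩ := eventually_atBot.1
        (hb.eventually (gt_mem_nhds (Real.exp_pos (s - 1))))
      refine ⟨1 + ∑ k ∈ Finset.Icc K₀ K₁, |M k|, ?_⟩
      filter_upwards [Ioo_mem_nhds (show s - 1 < s by linarith) (show s < s + 1 by linarith)]
        with y hy
      have hnn : ∀ i ∈ Finset.Icc K₀ K₁, 0 ≤ |M i| := fun i _ => abs_nonneg _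
      refine ⟨by have := Finset.sum_nonneg hnn; linarith, fun k h1 h2 => ?_⟩
      have hk1 : k ≤ K₁ := by
        by_contra! h
        have e1 : (2 : ℝ) ^ K₁ ≤ 2 ^ k := zpow_le_zpow_right₀ (by norm_num) h.le
        have e2 := Real.exp_lt_exp.2 hy.2
        linarith
      have hk0 : K₀ ≤ k := by
        by_contra! h
        have e1 := hK₀ k h.le
        have e2 := Real.exp_lt_exp.2 hy.1
        linarith
      have := Finset.single_le_sum hnn (Finset.mem_Icc.2 ⟨hk0, hk1⟩)
      linarith [le_abs_self (M k)])
  refine ⟨fun r => g (Real.log r), ?_, fun r _ => (hg _).1, fun k r h1 h2 => ?_⟩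
  · exact g.continuous.comp_continuousOn
      (Real.continuousOn_log.mono fun r hr => (ne_of_gt hr : r ≠ 0))
  · have hr : 0 < r := (zpow_pos (by norm_num) k).trans_le h1
    exact (hg (Real.log r)).2 k (by rwa [Real.exp_log hr]) (by rwa [Real.exp_log hr])

end Majorants

/-! ### Compactness of the shells around the target -/

/-- The points off `C` at bounded distance from `C` form a relatively compact set. -/
theorem mem_cthickening_frontier {n : ℕ} {C : Set (Euc n)} (hC : C.Nonempty) {z : Euc n}
    (hz : z ∉ C) {R : ℝ} (hR : Metric.infDist z C ≤ R) :
    z ∈ Metric.cthickening R (frontier C) := by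
  obtain ⟨y, hy, hd⟩ := exists_mem_frontier_infDist_compl_eq_dist (s := Cᶜ) (x := z) hz
    (by simpa using hC.ne_empty)
  rw [compl_compl] at hd
  rw [frontier_compl] at hy
  exact Metric.mem_cthickening_of_dist_le z y R _ hy (hd ▸ hR)

/-- A point off `C` has a nearest point on `∂C`, so the shell is a closed subset of a thickening of
the compact frontier, even when `C` is unbounded. -/
theorem isCompact_annulus {n : ℕ} {C : Set (Euc n)} (hC : C.Nonempty)
    (hf : IsCompact (frontier C)) {r R : ℝ} (hr : 0 < r) :
    IsCompact {z | r ≤ Metric.infDist z C ∧ Metric.infDist z C ≤ R} := by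
  refine (hf.cthickening (r := R)).of_isClosed_subset ?_ ?_
  · have hc := Metric.continuous_infDist_pt C
    exact (isClosed_le continuous_const hc).inter (isClosed_le hc continuous_const)
  · rintro z ⟨h1, h2⟩
    refine mem_cthickening_frontier hC (fun hz => ?_) h2
    rw [Metric.infDist_zero_of_mem hz] at h1
    linarith


/-! ### Carathéodory equations and the radial retraction -/

section Caratheodory

variable {E : Type*} [NormedAddCommGroup E] [NormedSpace ℝ E]

/-- Solvability of a globally Lipschitz Carathéodory integral equation with equilibrium `0`,
with an a priori bound. -/
theorem exists_caratheodory_solution [CompleteSpace E] [SecondCountableTopology E]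
    [MeasurableSpace E] [BorelSpace E] {H : ℝ → E → E} {L b : ℝ} (hb : 0 ≤ b) (hL : 0 < L)
    (hH0 : ∀ s, H s 0 = 0) (hLip : ∀ s a c, ‖H s a - H s c‖ ≤ L * ‖a - c‖)
    (hmeas : ∀ w : ℝ → E, Continuous w → Measurable fun s => H s (w s)) (w₀ : E) :
    ∃ w : ℝ → E, Continuous w ∧ (∀ t ∈ Icc 0 b, w t = w₀ + ∫ s in (0 : ℝ)..t, H s (w s)) ∧
      ∀ t ∈ Icc 0 b, ‖w t‖ ≤ 2 * Real.exp (2 * L * b) * ‖w₀‖ := by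
  have hint : ∀ w : ℝ → E, Continuous w → ∀ p q,
      IntervalIntegrable (fun s => H s (w s)) volume p q := by
    intro w hw p q
    refine ((continuous_const.mul hw.norm : Continuous fun s => L * ‖w s‖).intervalIntegrable
      p q).mono_fun (hmeas w hw).aestronglyMeasurable ?_
    filter_upwards with s
    have := hLip s (w s) 0
    rw [hH0, sub_zero, sub_zero] at this
    exact this.trans (le_abs_self _)
  -- The exponential weight makes the Picard operator a contraction with constant `1/2` whatever the
  -- length `b`.
  let W : C(Icc 0 b, E) → ℝ → E := fun v s => Real.exp (2 * L * s) • v (projIcc 0 b hb s)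
  have hW : ∀ v, Continuous (W v) := fun v =>
    (Real.continuous_exp.comp (continuous_const.mul continuous_id)).smul
      (v.continuous.comp continuous_projIcc)
  let Φ : C(Icc 0 b, E) → C(Icc 0 b, E) := fun v =>
    ⟨fun t => Real.exp (-(2 * L * t)) • (w₀ + ∫ s in (0 : ℝ)..t, H s (W v s)), by
      refine Continuous.smul (by fun_prop) (continuous_const.add ?_)
      exact (intervalIntegral.continuous_primitive (hint _ (hW v)) 0).comp continuous_subtype_val⟩
  have hΦ : ∀ v v', dist (Φ v) (Φ v') ≤ 2⁻¹ * dist v v' := by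
    intro v v'
    refine (ContinuousMap.dist_le (by positivity)).2 fun t => ?_
    have e1 : Φ v t - Φ v' t = Real.exp (-(2 * L * t)) •
        ∫ s in (0 : ℝ)..t, (H s (W v s) - H s (W v' s)) := by
      rw [intervalIntegral.integral_sub (hint _ (hW v) _ _) (hint _ (hW v') _ _)]
      simp only [Φ, ContinuousMap.coe_mk, ← smul_sub]
      congr 1
      abel
    have e2 : ‖∫ s in (0 : ℝ)..t, (H s (W v s) - H s (W v' s))‖ ≤
        ∫ s in (0 : ℝ)..t, L * dist v v' * Real.exp (2 * L * s) := by
      refine intervalIntegral.norm_integral_le_of_norm_le t.2.1 ?_ ?_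
      · filter_upwards with s _
        refine (hLip _ _ _).trans ?_
        simp only [W, ← smul_sub]
        rw [norm_smul, Real.norm_eq_abs, abs_of_pos (Real.exp_pos _), ← dist_eq_norm]
        have := ContinuousMap.dist_apply_le_dist (f := v) (g := v') (projIcc 0 b hb s)
        have h2 := mul_le_mul_of_nonneg_left this (mul_pos hL (Real.exp_pos (2 * L * s))).le
        linarith
      · exact Continuous.intervalIntegrable (by fun_prop) _ _
    have e3 : ∫ s in (0 : ℝ)..t, L * dist v v' * Real.exp (2 * L * s) =
        2⁻¹ * dist v v' * (Real.exp (2 * L * t) - 1) := by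
      rw [intervalIntegral.integral_const_mul,
        intervalIntegral.integral_comp_mul_left (fun s => Real.exp s) (by positivity), integral_exp]
      simp only [mul_zero, Real.exp_zero, smul_eq_mul]
      field_simp
    rw [dist_eq_norm, e1, norm_smul, Real.norm_eq_abs, abs_of_pos (Real.exp_pos _)]
    have e4 : Real.exp (-(2 * L * t)) * Real.exp (2 * L * t) = 1 := by
      rw [← Real.exp_add]; simp
    have e5 := mul_le_mul_of_nonneg_left (e2.trans e3.le) (Real.exp_pos (-(2 * L * t))).le
    have e6 : 0 ≤ dist v v' * Real.exp (-(2 * L * t)) := by positivity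
    calc _ ≤ _ := e5
      _ = 2⁻¹ * dist v v' * (Real.exp (-(2 * L * t)) * Real.exp (2 * L * t))
          - 2⁻¹ * (dist v v' * Real.exp (-(2 * L * t))) := by ring
      _ ≤ _ := by rw [e4]; linarith
  have hcontr : ContractingWith 2⁻¹ Φ := by
    refine ⟨by
      rw [← NNReal.coe_lt_coe]; norm_num, LipschitzWith.of_dist_le_mul fun v v' => ?_⟩
    simpa using hΦ v v'
  have : Nonempty (Icc 0 b) := ⟨⟨0, le_rfl, hb⟩⟩
  obtain ⟨v, hv, -⟩ := hcontr.exists_fixedPoint 0 (edist_ne_top _ _)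
  have hvfix : Φ v = v := hv
  have heq : ∀ t ∈ Icc 0 b, W v t = w₀ + ∫ s in (0 : ℝ)..t, H s (W v s) := by
    intro t ht
    have h1 : v ⟨t, ht⟩ = Real.exp (-(2 * L * t)) • (w₀ + ∫ s in (0 : ℝ)..t, H s (W v s)) := by
      conv_lhs => rw [← hvfix]
      rfl
    have h2 : W v t = Real.exp (2 * L * t) • v ⟨t, ht⟩ := by
      simp only [W, projIcc_of_mem hb ht]
    rw [h2, h1, smul_smul, ← Real.exp_add]
    simp
  refine ⟨W v, hW v, heq, ?_⟩
  -- As `H s 0 = 0`, the operator moves `0` by at most `‖w₀‖`; a `1/2`-contraction then has its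
  -- fixed point within `2 * ‖w₀‖` of `0`.
  have hΦ0 : dist (Φ 0) 0 ≤ ‖w₀‖ := by
    refine (ContinuousMap.dist_le (norm_nonneg _)).2 fun t => ?_
    have h1 : Φ 0 t = Real.exp (-(2 * L * t)) • w₀ := by
      simp [Φ, W, hH0]
    rw [h1, ContinuousMap.zero_apply, dist_zero_right, norm_smul, Real.norm_eq_abs,
      abs_of_pos (Real.exp_pos _)]
    refine mul_le_of_le_one_left (norm_nonneg _) (Real.exp_le_one_iff.2 ?_)
    have := t.2.1
    simp only [Left.neg_nonpos_iff]
    positivity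
  have hvn : dist v 0 ≤ 2 * ‖w₀‖ := by
    have h1 := dist_triangle (Φ v) (Φ 0) 0
    have h2 := hΦ v 0
    rw [hvfix] at h1 h2
    linarith
  intro t ht
  have h3 : ‖v (projIcc 0 b hb t)‖ ≤ 2 * ‖w₀‖ := by
    have := ContinuousMap.dist_apply_le_dist (f := v) (g := 0) (projIcc 0 b hb t)
    rw [ContinuousMap.zero_apply, dist_zero_right] at this
    exact this.trans hvn
  have h4 : Real.exp (2 * L * t) ≤ Real.exp (2 * L * b) :=
    Real.exp_le_exp.2 (mul_le_mul_of_nonneg_left ht.2 (by positivity))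
  simp only [W]
  rw [norm_smul, Real.norm_eq_abs, abs_of_pos (Real.exp_pos _)]
  calc _ ≤ Real.exp (2 * L * b) * (2 * ‖w₀‖) :=
        mul_le_mul h4 h3 (norm_nonneg _) (Real.exp_pos _).le
    _ = _ := by ring

/-- The radial retraction onto the closed ball of radius `ε`. -/
def radialRetraction (ε : ℝ) (w : E) : E := (ε / max ε ‖w‖) • w

theorem radialRetraction_of_le {ε : ℝ} (hε : 0 < ε) {w : E} (hw : ‖w‖ ≤ ε) :
    radialRetraction ε w = w := by
  rw [radialRetraction, max_eq_left hw, div_self hε.ne', one_smul]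

theorem norm_radialRetraction_le {ε : ℝ} (hε : 0 < ε) (w : E) : ‖radialRetraction ε w‖ ≤ ε := by
  have hm : 0 < max ε ‖w‖ := hε.trans_le (le_max_left _ _)
  rw [radialRetraction, norm_smul, Real.norm_eq_abs, abs_of_pos (div_pos hε hm),
    div_mul_eq_mul_div, div_le_iff₀ hm]
  exact mul_le_mul_of_nonneg_left (le_max_right _ _) hε.le

theorem continuous_radialRetraction {ε : ℝ} (hε : 0 < ε) :
    Continuous (radialRetraction ε : E → E) := by
  refine Continuous.smul (continuous_const.div (continuous_const.max continuous_norm) ?_)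
    continuous_id
  exact fun w => (hε.trans_le (le_max_left _ _)).ne'

/-- The difference splits into a contracted copy of `v - w` and a multiple of `w` due to the change
of the scaling factor. Each has norm at most `‖v - w‖`. -/
theorem norm_radialRetraction_sub_le {ε : ℝ} (hε : 0 < ε) (v w : E) :
    ‖radialRetraction ε v - radialRetraction ε w‖ ≤ 2 * ‖v - w‖ := by
  set p := max ε ‖v‖ with hp
  set q := max ε ‖w‖ with hq
  have hp0 : 0 < p := hε.trans_le (le_max_left _ _)
  have hq0 : 0 < q := hε.trans_le (le_max_left _ _)
  have hεp : ε ≤ p := le_max_left _ _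
  have hwq : ‖w‖ ≤ q := le_max_right _ _
  have hqp : |q - p| ≤ ‖v - w‖ := by
    have h1 := abs_max_sub_max_le_abs ‖w‖ ‖v‖ ε
    rw [max_comm, max_comm ‖v‖, ← hp, ← hq] at h1
    rw [norm_sub_rev]
    exact h1.trans (abs_norm_sub_norm_le _ _)
  have e : radialRetraction ε v - radialRetraction ε w =
      (ε / p) • (v - w) + (ε * (q - p) / (p * q)) • w := by
    have : ε * (q - p) / (p * q) = ε / p - ε / q := by field_simp
    rw [this, radialRetraction, radialRetraction, smul_sub, sub_smul]
    abel
  have h1 : ‖(ε / p) • (v - w)‖ ≤ ‖v - w‖ := by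
    rw [norm_smul, Real.norm_eq_abs, abs_of_pos (div_pos hε hp0)]
    exact mul_le_of_le_one_left (norm_nonneg _) ((div_le_one hp0).2 hεp)
  have h2 : ‖(ε * (q - p) / (p * q)) • w‖ ≤ ‖v - w‖ := by
    rw [norm_smul, Real.norm_eq_abs, abs_div, abs_mul, abs_of_pos hε, abs_of_pos (mul_pos hp0 hq0),
      div_mul_eq_mul_div, div_le_iff₀ (mul_pos hp0 hq0)]
    calc ε * |q - p| * ‖w‖ ≤ p * ‖v - w‖ * q := by gcongr
      _ = _ := by ring
  rw [e]
  linarith [norm_add_le ((ε / p) • (v - w)) ((ε * (q - p) / (p * q)) • w)]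

end Caratheodory

/-! ### Arcs and continuous dependence on the initial state -/

/-- A trajectory on the compact interval `[0, b]` with controls bounded by `M`. -/
structure IsArc {n m : ℕ} (g : Euc n → Euc m → Euc n) (C : Set (Euc n)) (U : Set (Euc m))
    (M b : ℝ) (x : ℝ → Euc n) (u : ℝ → Euc m) : Prop where
  measurable : Measurable u
  control_mem : ∀ t, u t ∈ U
  control_le : ∀ t, ‖u t‖ ≤ M
  traj_mem : ∀ t ∈ Icc 0 b, x t ∉ C
  lipschitz : ∃ K, LipschitzOnWith K x (Icc 0 b)
  ode : ∀ᵐ t, t ∈ Ioo 0 b → HasDerivAt x (g (x t) (u t)) t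

variable {n m : ℕ} {g : Euc n → Euc m → Euc n} {C : Set (Euc n)} {U : Set (Euc m)}

theorem IsArc.restrict {M b b' : ℝ} {x : ℝ → Euc n} {u : ℝ → Euc m} (h : IsArc g C U M b x u)
    (hb : b' ≤ b) : IsArc g C U M b' x u where
  measurable := h.measurable
  control_mem := h.control_mem
  control_le := h.control_le
  traj_mem t ht := h.traj_mem t ⟨ht.1, ht.2.trans hb⟩
  lipschitz := h.lipschitz.imp fun _ hK => hK.mono (Icc_subset_Icc_right hb)
  ode := by
    filter_upwards [h.ode] with t ht ht'
    exact ht ⟨ht'.1, ht'.2.trans_le hb⟩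

theorem isCompact_controls (hU : IsClosed U) (M : ℝ) :
    IsCompact (U ∩ Metric.closedBall 0 M) :=
  (isCompact_closedBall 0 M).inter_left hU

theorem exists_bound_on_compact (hU : IsClosed U)
    (hg : ContinuousOn (fun p : Euc n × Euc m => g p.1 p.2) (Cᶜ ×ˢ U)) {K : Set (Euc n)}
    (hK : IsCompact K) (hKC : K ⊆ Cᶜ) (M : ℝ) :
    ∃ B, 0 ≤ B ∧ ∀ x ∈ K, ∀ u ∈ U, ‖u‖ ≤ M → ‖g x u‖ ≤ B := by
  obtain ⟨B, hB⟩ := (hK.prod (isCompact_controls hU M)).exists_bound_of_continuousOn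
    (hg.mono (prod_mono hKC inter_subset_left))
  refine ⟨max B 0, le_max_right _ _, fun x hx u hu huM => ?_⟩
  exact (hB (x, u) ⟨hx, hu, by simpa using huM⟩).trans (le_max_left _ _)

theorem Icc_subset_timeDomain {T : EReal} {b : ℝ} (hb : b ∈ timeDomain T) :
    Icc 0 b ⊆ timeDomain T := fun _ ht =>
  ⟨ht.1, (EReal.coe_le_coe_iff.2 ht.2).trans_lt hb.2⟩

/-- Every admissible trajectory is an arc on compact subintervals, after changing the control on
a null set. -/
theorem IsAdmissiblePair.exists_isArc (hU : IsClosed U)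
    (hg : ContinuousOn (fun p : Euc n × Euc m => g p.1 p.2) (Cᶜ ×ˢ U)) {T : EReal}
    {x : ℝ → Euc n} {u : ℝ → Euc m} (h : IsAdmissiblePair g C U T x u) {b : ℝ}
    (hb : b ∈ timeDomain T) : ∃ M u', IsArc g C U M b x u' := by
  classical
  have hsub := Icc_subset_timeDomain hb
  have h0 : (0 : ℝ) ∈ timeDomain T := hsub ⟨le_rfl, hb.1⟩
  have hmem := h.control_bdd b hb
  obtain ⟨u₁, hu₁m, hu₁⟩ := hmem.1
  have hu₁m := hu₁m.measurable
  set M₀ : ℝ := (eLpNorm u ⊤ (volume.restrict (Icc 0 b))).toReal with hM₀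
  have hle : ∀ᵐ t ∂(volume.restrict (Icc 0 b)), ‖u t‖ ≤ M₀ := by
    have hlt := hmem.2
    rw [eLpNorm_exponent_top] at hlt hM₀
    filter_upwards [ae_le_eLpNormEssSup (f := u) (μ := volume.restrict (Icc 0 b))] with t ht
    have := ENNReal.toReal_mono hlt.ne ht
    simpa [hM₀] using this
  -- `u 0` replaces the values of the control that leave `U` or exceed the bound, so `M` must
  -- dominate it as well.
  set M := max M₀ ‖u 0‖ with hM
  set S : Set ℝ := {t | u₁ t ∈ U ∩ Metric.closedBall 0 M} with hS
  have hSm : MeasurableSet S := hu₁m (isCompact_controls hU M).measurableSet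
  set u' : ℝ → Euc m := S.piecewise u₁ fun _ => u 0 with hu'
  have hu'mem : ∀ t, u' t ∈ U ∩ Metric.closedBall 0 M := by
    intro t
    by_cases ht : t ∈ S
    · rw [hu', piecewise_eq_of_mem _ _ _ ht]; exact ht
    · rw [hu', piecewise_eq_of_notMem _ _ _ ht]
      exact ⟨h.control_mem 0 h0, by simp [hM]⟩
  have hae : ∀ᵐ t, t ∈ Icc 0 b → u' t = u t := by
    rw [← ae_restrict_iff' measurableSet_Icc]
    filter_upwards [hu₁, hle, ae_restrict_mem measurableSet_Icc] with t h1 h2 h3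
    have : t ∈ S := by
      refine ⟨h1 ▸ h.control_mem t (hsub h3), ?_⟩
      rw [← h1, mem_closedBall_zero_iff]
      exact h2.trans (le_max_left _ _)
    rw [hu', piecewise_eq_of_mem _ _ _ this, h1]
  have hode : ∀ᵐ t, t ∈ Icc 0 b → HasDerivAt x (g (x t) (u' t)) t := by
    have h1 := ae_restrict_of_ae_restrict_of_subset hsub h.ode
    rw [ae_restrict_iff' measurableSet_Icc] at h1
    filter_upwards [h1, hae] with t h2 h3 ht
    rw [h3 ht]
    exact h2 ht
  have hAC := h.traj_ac b hb
  have hcx := hAC.continuousOn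
  rw [uIcc_of_le hb.1] at hcx
  obtain ⟨B, hB0, hB⟩ := exists_bound_on_compact hU hg (isCompact_Icc.image_of_continuousOn hcx)
    (by rintro _ ⟨t, ht, rfl⟩; exact h.traj_mem t (hsub ht)) M
  refine ⟨M, u', hu₁m.piecewise hSm measurable_const, fun t => (hu'mem t).1,
    fun t => by simpa using (hu'mem t).2, fun t ht => h.traj_mem t (hsub ht), ⟨B.toNNReal, ?_⟩, ?_⟩
  · refine lipschitzOnWith_of_ae_hasDerivAt_le (h := fun t => g (x t) (u' t)) hb.1 hB0 hAC ?_
    filter_upwards [hode] with t h1 ht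
    exact ⟨h1 ht, hB _ ⟨t, ht, rfl⟩ _ (hu'mem t).1 (by simpa using (hu'mem t).2)⟩
  · filter_upwards [hode] with t h1 ht using h1 (Ioo_subset_Icc_self ht)

/-- Superposition of a dynamics continuous on `Cᶜ × U` with measurable maps is measurable. -/
theorem measurable_comp_of_continuousOn
    (hg : ContinuousOn (fun p : Euc n × Euc m => g p.1 p.2) (Cᶜ ×ˢ U)) {y : ℝ → Euc n}
    {u : ℝ → Euc m} (hy : Measurable y) (hu : Measurable u) (hyC : ∀ t, y t ∉ C)
    (huU : ∀ t, u t ∈ U) : Measurable fun t => g (y t) (u t) := by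
  have h1 := hg.domRestrict.measurable
  have h2 : Measurable fun t => (⟨(y t, u t), hyC t, huU t⟩ : (Cᶜ ×ˢ U : Set (Euc n × Euc m))) :=
    (hy.prodMk hu).subtype_mk
  exact h1.comp h2

/-- Continuous dependence on the initial state, with the control fixed. -/
theorem IsArc.exists_perturbation (hC : IsClosed C) (hU : IsClosed U)
    (hl : LocallyLipschitzInState g C U) {M b ε : ℝ} (hb : 0 ≤ b) (hε : 0 < ε) {x : ℝ → Euc n}
    {u : ℝ → Euc m} (h : IsArc g C U M b x u) :
    ∃ δ, 0 < δ ∧ ∀ z, dist z (x 0) < δ → ∃ y, IsArc g C U M b y u ∧ y 0 = z ∧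
      ∀ t ∈ Icc 0 b, dist (y t) (x t) ≤ ε := by
  obtain ⟨Kx, hKx⟩ := h.lipschitz
  have hcx := hKx.continuousOn
  have hK₀ : IsCompact (x '' Icc 0 b) := isCompact_Icc.image_of_continuousOn hcx
  have hK₀C : x '' Icc 0 b ⊆ Cᶜ := by rintro _ ⟨t, ht, rfl⟩; exact h.traj_mem t ht
  obtain ⟨η₀, hη₀, hη₀C⟩ := hK₀.exists_cthickening_subset_open hC.isOpen_compl hK₀C
  -- Radius of a tube around the trajectory that stays off `C` and within the tolerance.
  set η := min η₀ ε with hη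
  have hη0 : 0 < η := lt_min hη₀ hε
  set K := Metric.cthickening η (x '' Icc 0 b) with hK
  have hKc : IsCompact K := hK₀.cthickening
  have hKC : K ⊆ Cᶜ := (Metric.cthickening_mono (min_le_left _ _) _).trans hη₀C
  obtain ⟨L, hL, hLip⟩ := hl.lipschitz K (U ∩ Metric.closedBall 0 M) hKc hKC
    (isCompact_controls hU M) inter_subset_left
  obtain ⟨B, hB0, hB⟩ := exists_bound_on_compact hU hl.continuousOn hKc hKC M
  set X : ℝ → Euc n := fun s => x (projIcc 0 b hb s) with hX
  have hXc : Continuous X := hcx.domRestrict.comp continuous_projIcc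
  have hXmem : ∀ s, X s ∈ x '' Icc 0 b := fun s => ⟨_, (projIcc 0 b hb s).2, rfl⟩
  have hXx : ∀ s ∈ Icc 0 b, X s = x s := fun s hs => by simp only [hX, projIcc_of_mem hb hs]
  have hXK : ∀ s (w : Euc n), ‖w‖ ≤ η → X s + w ∈ K := fun s w hw =>
    Metric.mem_cthickening_of_dist_le _ (X s) _ _ (hXmem s) (by simpa [dist_eq_norm] using hw)
  have hXK0 : ∀ s, X s ∈ K := fun s => by simpa using hXK s 0 (by simpa using hη0.le)
  have hu1 : ∀ s, u s ∈ U ∩ Metric.closedBall 0 M := fun s =>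
    ⟨h.control_mem s, by simpa using h.control_le s⟩
  -- The equation of the deviation `w = y - x`. The retraction keeps the state in the tube, which
  -- makes `H` globally Lipschitz in `w` with equilibrium `0`.
  set H : ℝ → Euc n → Euc n := fun s w =>
    g (X s + radialRetraction η w) (u s) - g (X s) (u s) with hH
  have hHm : ∀ w : ℝ → Euc n, Continuous w → Measurable fun s => H s (w s) := by
    intro w hw
    refine Measurable.sub ?_ ?_
    · exact measurable_comp_of_continuousOn hl.continuousOn
        (hXc.add ((continuous_radialRetraction hη0).comp hw)).measurable h.measurable
        (fun s => hKC (hXK s _ (norm_radialRetraction_le hη0 _))) h.control_mem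
    · exact measurable_comp_of_continuousOn hl.continuousOn hXc.measurable h.measurable
        (fun s => hKC (hXK0 s)) h.control_mem
  have hHb : ∀ s w, ‖H s w‖ ≤ B + B := by
    intro s w
    refine (norm_sub_le _ _).trans (add_le_add ?_ ?_)
    · exact hB _ (hXK s _ (norm_radialRetraction_le hη0 _)) _ (h.control_mem s) (h.control_le s)
    · exact hB _ (hXK0 s) _ (h.control_mem s) (h.control_le s)
  have hH0 : ∀ s, H s 0 = 0 := by
    intro s
    simp [hH, radialRetraction]
  have hHL : ∀ s a c, ‖H s a - H s c‖ ≤ 2 * L * ‖a - c‖ := by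
    intro s a c
    have h1 := hLip _ (hXK s _ (norm_radialRetraction_le hη0 a)) _
      (hXK s _ (norm_radialRetraction_le hη0 c)) _ (hu1 s)
    have h2 := norm_radialRetraction_sub_le hη0 a c
    simp only [hH, sub_sub_sub_cancel_right]
    rw [add_sub_add_left_eq_sub] at h1
    calc _ ≤ _ := h1
      _ ≤ L * (2 * ‖a - c‖) := mul_le_mul_of_nonneg_left h2 hL.le
      _ = _ := by ring
  set A := 2 * Real.exp (2 * (2 * L) * b) with hA
  have hA0 : 0 < A := by positivity
  -- By the a priori bound with factor `A`, deviations starting below `η / A` stay within `η`, where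
  -- the retraction is the identity and `x + w` solves the original equation.
  refine ⟨η / A, div_pos hη0 hA0, fun z hz => ?_⟩
  obtain ⟨w, hwc, hw, hwb⟩ := exists_caratheodory_solution hb (by positivity) hH0 hHL hHm (z - x 0)
  have hwη : ∀ t ∈ Icc 0 b, ‖w t‖ ≤ η := by
    intro t ht
    refine (hwb t ht).trans ?_
    rw [dist_eq_norm, lt_div_iff₀ hA0] at hz
    rw [mul_comm]
    exact hz.le
  have hFL := lipschitzWith_integral (hHm w hwc) (by positivity) fun s => hHb s (w s)
  refine ⟨fun t => x t + w t, ⟨h.measurable, h.control_mem, h.control_le, ?_, ?_, ?_⟩, ?_, ?_⟩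
  · intro t ht
    rw [← hXx t ht]
    exact hKC (hXK t _ (hwη t ht))
  · refine ⟨Kx + (B + B).toNNReal, hKx.add (LipschitzOnWith.of_dist_le_mul fun s hs t ht => ?_)⟩
    rw [hw s hs, hw t ht, dist_add_left]
    exact hFL.dist_le_mul s t
  · filter_upwards [h.ode, ae_hasDerivAt_integral_of_bounded (hHm w hwc) fun s => hHb s (w s)]
      with t h1 h2 ht
    have ht' := Ioo_subset_Icc_self ht
    have h3 : HasDerivAt w (H t (w t)) t := by
      refine (h2.const_add (z - x 0)).congr_of_eventuallyEq ?_
      filter_upwards [Ioo_mem_nhds ht.1 ht.2] with s hs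
      exact hw s (Ioo_subset_Icc_self hs)
    have h4 := (h1 ht).add h3
    have h5 : g (x t) (u t) + H t (w t) = g (x t + w t) (u t) := by
      simp only [hH, radialRetraction_of_le hη0 (hwη t ht'), hXx t ht']
      abel
    rw [h5] at h4
    exact h4
  · have := hw 0 ⟨le_rfl, hb⟩
    simp [this]
  · intro t ht
    rw [dist_eq_norm, add_sub_cancel_left]
    exact (hwη t ht).trans (min_le_right _ _)

/-! ### Descent through dyadic shells -/

/-- From every state at distance in `(2 ^ k, 2 ^ (k + 1)]` the distance to `C` can be halved down
to `2 ^ k`, with time, control size and overshoot bounded in terms of `k`. -/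
def HasDescent (g : Euc n → Euc m → Euc n) (C : Set (Euc n)) (U : Set (Euc m)) : Prop :=
  ∃ b T M : ℤ → ℝ, Monotone b ∧ Tendsto b atBot (𝓝 0) ∧
    ∀ (k : ℤ) (z : Euc n), (2 : ℝ) ^ k < Metric.infDist z C →
      Metric.infDist z C ≤ (2 : ℝ) ^ (k + 1) →
      ∃ (τ : ℝ) (x : ℝ → Euc n) (u : ℝ → Euc m), IsArc g C U (M k) τ x u ∧ 0 < τ ∧ τ ≤ T k ∧
        x 0 = z ∧ Metric.infDist (x τ) C = (2 : ℝ) ^ k ∧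
        ∀ t ∈ Icc 0 τ, (2 : ℝ) ^ k ≤ Metric.infDist (x t) C ∧ Metric.infDist (x t) C ≤ b k

theorem IsArc.mono {M M' b : ℝ} {x : ℝ → Euc n} {u : ℝ → Euc m} (h : IsArc g C U M b x u)
    (hM : M ≤ M') : IsArc g C U M' b x u :=
  ⟨h.measurable, h.control_mem, fun t => (h.control_le t).trans hM, h.traj_mem, h.lipschitz, h.ode⟩

/-- The first time at which a continuous function reaches a lower level. -/
theorem exists_first_time {d : ℝ → ℝ} {s r : ℝ} (hs : 0 ≤ s) (hd : ContinuousOn d (Icc 0 s))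
    (h0 : r < d 0) (h1 : d s ≤ r) :
    ∃ τ ∈ Ioc 0 s, d τ = r ∧ ∀ t ∈ Icc 0 τ, r ≤ d t := by
  have hc : IsCompact (Icc 0 s ∩ d ⁻¹' {r}) :=
    isCompact_Icc.of_isClosed_subset (hd.preimage_isClosed_of_isClosed isClosed_Icc
      isClosed_singleton) inter_subset_left
  obtain ⟨t₀, ht₀, e₀⟩ := intermediate_value_Icc' hs hd ⟨h1, h0.le⟩
  obtain ⟨τ, ⟨hτ, hτr⟩, hmin⟩ := hc.exists_isLeast ⟨t₀, ht₀, e₀⟩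
  have hτr : d τ = r := hτr
  have hτ0 : τ ≠ 0 := fun h => by rw [h] at hτr; exact h0.ne' hτr
  refine ⟨τ, ⟨lt_of_le_of_ne hτ.1 hτ0.symm, hτ.2⟩, hτr, fun t ht => ?_⟩
  by_contra! hlt
  obtain ⟨t₁, ht₁, e₁⟩ := intermediate_value_Icc' ht.1
    (hd.mono (Icc_subset_Icc_right (ht.2.trans hτ.2))) ⟨hlt.le, h0.le⟩
  have h2 : τ ≤ t₁ := hmin ⟨⟨ht₁.1, ht₁.2.trans (ht.2.trans hτ.2)⟩, e₁⟩
  have h3 : t = τ := le_antisymm ht.2 (h2.trans ht₁.2)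
  rw [h3, hτr] at hlt
  exact lt_irrefl _ hlt

theorem IsKL.mono_left {β : ℝ → ℝ → ℝ} (hβ : IsKL β) {r s t : ℝ} (hr : 0 ≤ r) (hrs : r ≤ s)
    (ht : 0 ≤ t) : β r t ≤ β s t :=
  (hβ.strictMonoOn t ht).monotoneOn hr (hr.trans hrs) hrs

theorem IsKL.anti_right {β : ℝ → ℝ → ℝ} (hβ : IsKL β) {r t : ℝ} (hr : 0 < r) (ht : 0 ≤ t) :
    β r t ≤ β r 0 :=
  (hβ.strictAntiOn r hr).antitoneOn (mem_Ici.2 le_rfl) ht ht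

theorem IsKL.tendsto_nhds_zero {β : ℝ → ℝ → ℝ} (hβ : IsKL β) :
    Tendsto (fun r => β r 0) (𝓝[≥] 0) (𝓝 0) := by
  have h1 := hβ.continuousOn ((0 : ℝ), (0 : ℝ)) ⟨mem_Ici.2 le_rfl, mem_Ici.2 le_rfl⟩
  rw [ContinuousWithinAt, hβ.zero 0 le_rfl] at h1
  refine h1.comp (f := fun r : ℝ => (r, (0 : ℝ))) (tendsto_nhdsWithin_iff.2 ⟨?_, ?_⟩)
  · exact ((continuous_id.prodMk continuous_const).tendsto' (0 : ℝ) ((0 : ℝ), (0 : ℝ)) rfl).mono_left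
      nhdsWithin_le_nhds
  · filter_upwards [self_mem_nhdsWithin] with r hr using ⟨hr, mem_Ici.2 le_rfl⟩

theorem tendsto_two_zpow_atBot : Tendsto (fun k : ℤ => (2 : ℝ) ^ k) atBot (𝓝 0) := by
  refine Metric.tendsto_nhds.2 fun ε hε => ?_
  obtain ⟨N, hN⟩ := exists_pow_lt_of_lt_one hε (show (2⁻¹ : ℝ) < 1 by norm_num)
  filter_upwards [eventually_le_atBot (-(N : ℤ))] with k hk
  rw [Real.dist_eq, sub_zero, abs_of_pos (zpow_pos (by norm_num) k)]
  have h1 : (2 : ℝ) ^ k ≤ 2 ^ (-(N : ℤ)) := zpow_le_zpow_right₀ (by norm_num) hk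
  have h2 : (2 : ℝ) ^ (-(N : ℤ)) = 2⁻¹ ^ N := by simp
  linarith

/-- An admissible trajectory obeying a `𝒦ℒ` bound comes close to `C` in uniform time. -/
theorem IsAdmissiblePair.exists_time_infDist_lt {T : EReal} {x : ℝ → Euc n} {u : ℝ → Euc m}
    (h : IsAdmissiblePair g C U T x u) {β : ℝ → ℝ → ℝ} {R t₀ ε : ℝ} (hε : 0 < ε) (ht₀ : 0 ≤ t₀)
    (hb : Metric.infDist (x t₀) C ≤ β R t₀) (hβ : β R t₀ < ε) :
    ∃ s ∈ timeDomain T, s ≤ t₀ ∧ Metric.infDist (x s) C < ε := by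
  by_cases hT : (t₀ : EReal) < T
  · exact ⟨t₀, ⟨ht₀, hT⟩, le_rfl, hb.trans_lt hβ⟩
  -- The trajectory ends at `C` by time `t₀`, so it is already close to `C` shortly before its final
  -- time.
  · rw [not_lt] at hT
    have htop : T ≠ ⊤ := fun e => by
      rw [e] at hT
      exact (EReal.coe_lt_top t₀).not_ge hT
    have hbot : T ≠ ⊥ := fun e => by
      have := h.pos
      rw [e] at this
      exact not_lt_bot this
    obtain ⟨S, rfl⟩ : ∃ S : ℝ, T = S := ⟨T.toReal, (EReal.coe_toReal htop hbot).symm⟩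
    have hS : 0 < S := by exact_mod_cast h.pos
    have hSt : S ≤ t₀ := by exact_mod_cast hT
    obtain ⟨s, hs1, hs2⟩ := (((h.terminal S rfl).1.eventually (gt_mem_nhds hε)).and
      (Ioo_mem_nhdsLT hS)).exists
    exact ⟨s, ⟨hs2.1.le, by exact_mod_cast hs2.2⟩, hs2.2.le.trans hSt, hs1⟩

/-- The reference trajectory falls below `2 ^ k / 2` by time `T k`; a perturbation of at most `2 ^ k
/ 4` still crosses the level `2 ^ k`, where it is stopped. Only the control bound depends on the
reference state, and compactness of the shell makes it uniform. -/
theorem IsGAC.hasDescent (hCn : C.Nonempty) (hC : IsClosed C) (hCf : IsCompact (frontier C))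
    (hU : IsClosed U) (hl : LocallyLipschitzInState g C U) (h : IsGAC g C U) :
    HasDescent g C U := by
  obtain ⟨β, hβ, h⟩ := h
  have hpow : ∀ k : ℤ, (0 : ℝ) < 2 ^ k := fun k => zpow_pos (by norm_num) k
  have hT : ∀ k : ℤ, ∃ t₀ : ℝ, 0 ≤ t₀ ∧ β (2 ^ (k + 1)) t₀ < 2 ^ k / 2 := by
    intro k
    have h1 := (hβ.tendsto_zero _ (hpow (k + 1)).le).eventually (gt_mem_nhds (half_pos (hpow k)))
    obtain ⟨t₀, h2, h3⟩ := (h1.and (eventually_ge_atTop 0)).exists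
    exact ⟨t₀, h3, h2⟩
  choose T hT0 hTβ using hT
  -- The overshoot of the reference trajectory, plus room for the perturbation.
  set b : ℤ → ℝ := fun k => β (2 ^ (k + 1)) 0 + 2 ^ k with hb
  have key : ∀ k : ℤ, ∃ M : ℝ,
      ∀ z ∈ {z | (2 : ℝ) ^ k ≤ Metric.infDist z C ∧ Metric.infDist z C ≤ (2 : ℝ) ^ (k + 1)},
        (2 : ℝ) ^ k < Metric.infDist z C →
      ∃ (τ : ℝ) (x : ℝ → Euc n) (u : ℝ → Euc m), IsArc g C U M τ x u ∧ 0 < τ ∧ τ ≤ T k ∧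
        x 0 = z ∧ Metric.infDist (x τ) C = (2 : ℝ) ^ k ∧
        ∀ t ∈ Icc 0 τ, (2 : ℝ) ^ k ≤ Metric.infDist (x t) C ∧ Metric.infDist (x t) C ≤ b k := by
    intro k
    -- Compactness needs the closed shell, while the descent is only asserted strictly above the
    -- level `2 ^ k`. Finite unions are handled by the maximum of the control bounds.
    refine (isCompact_annulus hCn hCf (R := (2 : ℝ) ^ (k + 1)) (hpow k)).induction_on
      (p := fun S => ∃ M : ℝ, ∀ z ∈ S, (2 : ℝ) ^ k < Metric.infDist z C →
        ∃ (τ : ℝ) (x : ℝ → Euc n) (u : ℝ → Euc m), IsArc g C U M τ x u ∧ 0 < τ ∧ τ ≤ T k ∧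
        x 0 = z ∧ Metric.infDist (x τ) C = (2 : ℝ) ^ k ∧
        ∀ t ∈ Icc 0 τ, (2 : ℝ) ^ k ≤ Metric.infDist (x t) C ∧ Metric.infDist (x t) C ≤ b k)
      ⟨0, fun z hz => absurd hz (notMem_empty z)⟩ ?_ ?_ ?_
    · rintro S S' hSS ⟨M, hM⟩
      exact ⟨M, fun z hz => hM z (hSS hz)⟩
    · rintro S S' ⟨M, hM⟩ ⟨M', hM'⟩
      refine ⟨max M M', fun z hz hzk => ?_⟩
      rcases hz with hz | hz
      · obtain ⟨τ, x, u, h1, h2⟩ := hM z hz hzk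
        exact ⟨τ, x, u, h1.mono (le_max_left _ _), h2⟩
      · obtain ⟨τ, x, u, h1, h2⟩ := hM' z hz hzk
        exact ⟨τ, x, u, h1.mono (le_max_right _ _), h2⟩
    · rintro z ⟨hz1, hz2⟩
      have hz0 : 0 < Metric.infDist z C := (hpow k).trans_le hz1
      have hzC : z ∉ C := fun hz => by rw [Metric.infDist_zero_of_mem hz] at hz0; exact hz0.false
      obtain ⟨S, x, u, hadm, hx0, hxβ⟩ := h z hzC
      have hxβ' : ∀ t, 0 ≤ t → Metric.infDist (x t) C ≤ β (2 ^ (k + 1)) t := fun t ht =>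
        (hxβ t ht).trans (hβ.mono_left Metric.infDist_nonneg hz2 ht)
      obtain ⟨s, hs, hsT, hsd⟩ := hadm.exists_time_infDist_lt (half_pos (hpow k)) (hT0 k)
        (hxβ' _ (hT0 k)) (hTβ k)
      obtain ⟨M, u', harc⟩ := hadm.exists_isArc hU hl.continuousOn hs
      obtain ⟨δ, hδ, hpert⟩ := harc.exists_perturbation hC hU hl hs.1
        (show (0 : ℝ) < 2 ^ k / 4 by have := hpow k; positivity)
      refine ⟨Metric.ball z δ, mem_nhdsWithin_of_mem_nhds (Metric.ball_mem_nhds z hδ), M, ?_⟩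
      intro z' hz' hz'k
      rw [Metric.mem_ball, ← hx0] at hz'
      obtain ⟨y, hy, hy0, hyx⟩ := hpert z' hz'
      have hyd : ∀ t ∈ Icc 0 s, Metric.infDist (y t) C ≤ Metric.infDist (x t) C + 2 ^ k / 4 :=
        fun t ht => (Metric.infDist_le_infDist_add_dist (y := x t)).trans
          (by linarith [hyx t ht])
      obtain ⟨Ky, hKy⟩ := hy.lipschitz
      obtain ⟨τ, hτ, hτk, hτmin⟩ := exists_first_time (d := fun t => Metric.infDist (y t) C) hs.1
        ((Metric.continuous_infDist_pt C).comp_continuousOn hKy.continuousOn)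
        (by simpa only [hy0] using hz'k)
        (by
          have := hyd s ⟨hs.1, le_rfl⟩
          have := hpow k
          linarith)
      refine ⟨τ, y, u', hy.restrict hτ.2, hτ.1, hτ.2.trans hsT, hy0, hτk, fun t ht =>
        ⟨hτmin t ht, ?_⟩⟩
      have h1 := hyd t ⟨ht.1, ht.2.trans hτ.2⟩
      have h2 := hxβ' t ht.1
      have h3 := hβ.anti_right (hpow (k + 1)) ht.1
      have h4 := hpow k
      simp only [hb]
      linarith
  choose M hM using key
  refine ⟨b, T, M, ?_, ?_, fun k z hz1 hz2 => hM k z ⟨hz1.le, hz2⟩ hz1⟩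
  · intro k l hkl
    have e1 : (2 : ℝ) ^ k ≤ 2 ^ l := zpow_le_zpow_right₀ (by norm_num) hkl
    have e2 : (2 : ℝ) ^ (k + 1) ≤ 2 ^ (l + 1) := zpow_le_zpow_right₀ (by norm_num) (by linarith)
    exact add_le_add (hβ.mono_left (hpow _).le e2 le_rfl) e1
  · have h1 : Tendsto (fun k : ℤ => (2 : ℝ) ^ (k + 1)) atBot (𝓝[≥] 0) := by
      refine tendsto_nhdsWithin_iff.2 ⟨?_, Eventually.of_forall fun k => (hpow _).le⟩
      exact tendsto_two_zpow_atBot.comp (tendsto_atBot_add_const_right _ 1 tendsto_id)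
    simpa using (hβ.tendsto_nhds_zero.comp h1).add tendsto_two_zpow_atBot

/-! ### Time changes -/

/-- Reparametrization of an arc by a bounded rate depending on the control. -/
theorem IsArc.timeChange {M b : ℝ} {x : ℝ → Euc n} {u : ℝ → Euc m} (h : IsArc g C U M b x u)
    (hb : 0 < b) {ρ : Euc m → ℝ} (hρ : Measurable ρ) {c B : ℝ} (hc : 0 < c)
    (hρc : ∀ v, ‖v‖ ≤ M → c ≤ ρ v) (hρB : ∀ v, ‖v‖ ≤ M → ρ v ≤ B) :
    ∃ (b' : ℝ) (y : ℝ → Euc n) (v : ℝ → Euc m),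
      IsArc (fun x u => (ρ u)⁻¹ • g x u) C U M b' y v ∧ 0 < b' ∧ b' ≤ B * b ∧ y 0 = x 0 ∧
        y b' = x b ∧ ∀ t ∈ Icc 0 b', ∃ s ∈ Icc 0 b, y t = x s := by
  have hrc : ∀ t, c ≤ ρ (u t) := fun t => hρc _ (h.control_le t)
  have hrB : ∀ t, ρ (u t) ≤ B := fun t => hρB _ (h.control_le t)
  have hrm : Measurable fun t => ρ (u t) := hρ.comp h.measurable
  have hrn : ∀ t, ‖ρ (u t)‖ ≤ B := fun t => by
    rw [Real.norm_eq_abs, abs_of_pos (hc.trans_le (hrc t))]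
    exact hrB t
  have hB : 0 ≤ B := (norm_nonneg _).trans (hrn 0)
  -- The new clock. As `c ≤ ρ (u t) ≤ B`, it is a bi-Lipschitz bijection of the line; its inverse
  -- `ψ` reparametrizes the arc.
  set φ : ℝ → ℝ := fun t => ∫ s in (0 : ℝ)..t, ρ (u s) with hφ
  have hφL : LipschitzWith B.toNNReal φ := lipschitzWith_integral hrm hB hrn
  have hφ0 : φ 0 = 0 := by simp [hφ]
  have hlow : ∀ s t, s ≤ t → c * (t - s) ≤ φ t - φ s := by
    intro s t hst
    have e1 : φ t - φ s = ∫ r in s..t, ρ (u r) :=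
      intervalIntegral.integral_interval_sub_left (intervalIntegrable_of_bounded hrm hrn _ _)
        (intervalIntegrable_of_bounded hrm hrn _ _)
    have e2 : ∫ r in s..t, c ≤ ∫ r in s..t, ρ (u r) :=
      intervalIntegral.integral_mono_on hst (by simp) (intervalIntegrable_of_bounded hrm hrn _ _)
        fun r _ => hrc r
    rw [intervalIntegral.integral_const, smul_eq_mul] at e2
    linarith
  have hmono : StrictMono φ := by
    intro s t hst
    have := hlow s t hst.le
    have : 0 < c * (t - s) := mul_pos hc (by linarith)
    linarith
  have hsurj : Function.Surjective φ := by
    refine hφL.continuous.surjective ?_ ?_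
    · refine tendsto_atTop_mono' atTop ?_ (tendsto_id.const_mul_atTop hc)
      filter_upwards [eventually_ge_atTop 0] with t ht
      have := hlow 0 t ht
      simp only [id]
      linarith
    · refine tendsto_atBot_mono' atBot ?_ (tendsto_id.const_mul_atBot hc)
      filter_upwards [eventually_le_atBot 0] with t ht
      have := hlow t 0 ht
      simp only [id]
      linarith
  set e : ℝ ≃o ℝ := hmono.orderIsoOfSurjective φ hsurj with he
  set ψ : ℝ → ℝ := fun t => e.symm t with hψ
  have hφψ : ∀ t, φ (ψ t) = t := fun t => e.apply_symm_apply t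
  have hψφ : ∀ t, ψ (φ t) = t := fun t => e.symm_apply_apply t
  have hψm : Monotone ψ := e.symm.monotone
  have hψ0 : ψ 0 = 0 := by rw [← hφ0, hψφ, hφ0]
  have hψL : LipschitzWith (c⁻¹).toNNReal ψ := by
    refine LipschitzWith.of_dist_le_mul fun s t => ?_
    wlog hst : s ≤ t generalizing s t
    · rw [dist_comm, dist_comm s t]
      exact this t s (le_of_not_ge hst)
    have h1 := hlow _ _ (hψm hst)
    have h2 := hψm hst
    rw [hφψ, hφψ] at h1
    rw [dist_comm, dist_comm s t, Real.dist_eq, Real.dist_eq, abs_of_nonneg (by linarith),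
      abs_of_nonneg (by linarith), Real.coe_toNNReal _ (by positivity),
      inv_mul_eq_div, le_div_iff₀ hc]
    linarith
  have hmaps : MapsTo ψ (Icc 0 (φ b)) (Icc 0 b) := fun t ht =>
    ⟨by rw [← hψ0]; exact hψm ht.1, by rw [← hψφ b]; exact hψm ht.2⟩
  obtain ⟨Kx, hKx⟩ := h.lipschitz
  refine ⟨φ b, x ∘ ψ, u ∘ ψ, ⟨h.measurable.comp hψm.measurable, fun t => h.control_mem _,
    fun t => h.control_le _, fun t ht => h.traj_mem _ (hmaps ht),
    ⟨_, hKx.comp hψL.lipschitzOnWith hmaps⟩, ?_⟩, ?_, ?_, ?_, ?_, ?_⟩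
  · have hN := (ae_hasDerivAt_integral_of_bounded hrm hrn).and h.ode
    rw [ae_iff] at hN
    -- A Lipschitz map of the line sends null sets to null sets, so the exceptional times remain
    -- negligible on the new clock.
    have hN' : volume (φ '' {t | ¬(HasDerivAt φ (ρ (u t)) t ∧
        (t ∈ Ioo 0 b → HasDerivAt x (g (x t) (u t)) t))}) = 0 := by
      have h1 := hφL.hausdorffMeasure_image_le (d := 1) zero_le_one
        {t | ¬(HasDerivAt φ (ρ (u t)) t ∧ (t ∈ Ioo 0 b → HasDerivAt x (g (x t) (u t)) t))}
      rw [hausdorffMeasure_real, hN, mul_zero] at h1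
      exact le_antisymm h1 zero_le
    filter_upwards [measure_eq_zero_iff_ae_notMem.1 hN'] with t ht htb
    have hnot : ¬¬(HasDerivAt φ (ρ (u (ψ t))) (ψ t) ∧
        (ψ t ∈ Ioo 0 b → HasDerivAt x (g (x (ψ t)) (u (ψ t))) (ψ t))) := fun hcon =>
      ht ⟨ψ t, hcon, hφψ t⟩
    obtain ⟨h1, h2⟩ := not_not.1 hnot
    have hψt : ψ t ∈ Ioo 0 b := by
      refine ⟨?_, ?_⟩
      · rw [← hψ0]; exact e.symm.strictMono htb.1
      · rw [← hψφ b]; exact e.symm.strictMono htb.2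
    have h3 : HasDerivAt ψ (ρ (u (ψ t)))⁻¹ t :=
      h1.of_local_left_inverse hψL.continuous.continuousAt (hc.trans_le (hrc _)).ne'
        (Eventually.of_forall hφψ)
    exact (h2 hψt).scomp t h3
  · rw [← hφ0]; exact hmono hb
  · have := hφL.dist_le_mul b 0
    rw [hφ0, Real.dist_eq, Real.dist_eq, sub_zero, sub_zero, Real.coe_toNNReal _ hB,
      abs_of_pos hb] at this
    exact (le_abs_self _).trans this
  · simp [hψ0]
  · simp [hψφ]
  · exact fun t ht => ⟨ψ t, hmaps ht, rfl⟩

/-- The path is unchanged, hence so are the levels and the overshoot; durations grow at most by the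
bound of `ρ` on controls of size `M k`. -/
theorem HasDescent.timeChange (h : HasDescent g C U) {ρ : Euc m → ℝ} (hρ : Measurable ρ)
    (hb : ∀ M : ℝ, ∃ c B : ℝ, 0 < c ∧ ∀ v, ‖v‖ ≤ M → c ≤ ρ v ∧ ρ v ≤ B) :
    HasDescent (fun x u => (ρ u)⁻¹ • g x u) C U := by
  obtain ⟨b, T, M, hbm, hb0, h⟩ := h
  choose c B hc hcB using hb
  refine ⟨b, fun k => B (M k) * T k, M, hbm, hb0, fun k z hz1 hz2 => ?_⟩
  obtain ⟨τ, x, u, harc, hτ, hτT, hx0, hxτ, hx⟩ := h k z hz1 hz2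
  obtain ⟨b', y, v, hy, hb', hb'B, hy0, hyb, hyx⟩ := harc.timeChange hτ hρ (hc (M k))
    (fun v hv => (hcB _ v hv).1) (fun v hv => (hcB _ v hv).2)
  have hB : 0 ≤ B (M k) := by
    have := hcB (M k) (u 0) (harc.control_le 0)
    linarith [hc (M k)]
  refine ⟨b', y, v, hy, hb', hb'B.trans (mul_le_mul_of_nonneg_left hτT hB), hy0.trans hx0,
    by rw [hyb, hxτ], fun t ht => ?_⟩
  obtain ⟨s, hs, e⟩ := hyx t ht
  rw [e]
  exact hx s hs

/-! ### Growth rates and the rescaled dynamics -/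

theorem IsGrowthRate.nonneg {ν : ℝ → ℝ} (hν : IsGrowthRate ν) {r : ℝ} (hr : 0 ≤ r) : 0 ≤ ν r :=
  hν.bijOn.mapsTo hr

/-- Extended by the identity to negative reals, `ν` is a monotone surjection of the line, hence
continuous. -/
theorem IsGrowthRate.continuous_comp_norm {ν : ℝ → ℝ} (hν : IsGrowthRate ν) :
    Continuous fun v : Euc m => ν ‖v‖ := by
  set μ : ℝ → ℝ := fun r => if 0 ≤ r then ν r else r with hμ
  have hmono : Monotone μ := by
    intro r s hrs
    simp only [hμ]
    split_ifs with h1 h2 h2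
    · exact hν.strictMonoOn.monotoneOn h1 h2 hrs
    · linarith
    · linarith [hν.nonneg h2]
    · exact hrs
  have hsurj : Function.Surjective μ := by
    intro r
    by_cases hr : 0 ≤ r
    · obtain ⟨s, hs, e⟩ := hν.bijOn.surjOn hr
      exact ⟨s, by simp only [hμ, if_pos (show 0 ≤ s from hs), e]⟩
    · exact ⟨r, by simp only [hμ, if_neg hr]⟩
  refine ((hmono.continuous_of_surjective hsurj).comp continuous_norm).congr fun v => ?_
  simp [hμ]

theorem LocallyLipschitzInState.rescaled {ν : ℝ → ℝ} (hν : IsGrowthRate ν)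
    (hl : LocallyLipschitzInState g C U) :
    LocallyLipschitzInState (ControlGAC.rescaled ν g) C U := by
  have hpos : ∀ v : Euc m, 1 ≤ 1 + ν ‖v‖ := fun v => by linarith [hν.nonneg (norm_nonneg v)]
  refine ⟨?_, fun K U₁ hK hKC hU₁ hU₁U => ?_⟩
  · have hc : Continuous fun p : Euc n × Euc m => (1 + ν ‖p.2‖)⁻¹ := ((continuous_const.add hν.continuous_comp_norm).inv₀
      fun v => (one_pos.trans_le (hpos v)).ne').comp continuous_snd
    exact hc.continuousOn.smul hl.continuousOn
  · obtain ⟨L, hL, h⟩ := hl.lipschitz K U₁ hK hKC hU₁ hU₁U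
    refine ⟨L, hL, fun x hx y hy v hv => ?_⟩
    rw [ControlGAC.rescaled, ControlGAC.rescaled, ← smul_sub, norm_smul, norm_inv,
      Real.norm_eq_abs, abs_of_pos (by linarith [hpos v])]
    exact (mul_le_of_le_one_left (norm_nonneg _) (inv_le_one_of_one_le₀ (hpos v))).trans
      (h x hx y hy v hv)

theorem IsGrowthRate.one_add_le {ν : ℝ → ℝ} (hν : IsGrowthRate ν) {M : ℝ} {v : Euc m}
    (hv : ‖v‖ ≤ M) : 1 ≤ 1 + ν ‖v‖ ∧ 1 + ν ‖v‖ ≤ 1 + ν M := by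
  have h1 := hν.nonneg (norm_nonneg v)
  have h2 := hν.strictMonoOn.monotoneOn (norm_nonneg v) ((norm_nonneg v).trans hv) hv
  constructor <;> linarith

theorem hasDescent_rescaled_iff {ν : ℝ → ℝ} (hν : IsGrowthRate ν) :
    HasDescent (rescaled ν g) C U ↔ HasDescent g C U := by
  have hm : Measurable fun v : Euc m => 1 + ν ‖v‖ :=
    (continuous_const.add hν.continuous_comp_norm).measurable
  constructor
  · intro h
    have h1 := h.timeChange (ρ := fun v => (1 + ν ‖v‖)⁻¹) hm.inv fun M =>
      -- `M` may be negative, where nothing is known about `ν`.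
      ⟨(1 + ν (max M 0))⁻¹, 1,
        inv_pos.2 (by linarith [hν.nonneg (le_max_right M 0)]), fun v hv => by
          obtain ⟨h2, h3⟩ := hν.one_add_le (hv.trans (le_max_left M 0))
          exact ⟨inv_anti₀ (by linarith) h3, inv_le_one_of_one_le₀ h2⟩⟩
    have e : (fun x u => ((fun v : Euc m => (1 + ν ‖v‖)⁻¹) u)⁻¹ • rescaled ν g x u) = g := by
      funext x v
      have := hν.nonneg (norm_nonneg v)
      rw [rescaled, inv_inv, smul_inv_smul₀ (by linarith)]
    rwa [e] at h1
  · intro h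
    exact h.timeChange hm fun M => ⟨1, 1 + ν M, one_pos, fun v hv => hν.one_add_le hv⟩

/-! ### Concatenation of arcs -/

theorem exists_mem_Ico_of_lt {t : ℕ → ℝ} {s : ℝ} (h0 : t 0 ≤ s) (h : ∃ j, s < t j) :
    ∃ j, s ∈ Ico (t j) (t (j + 1)) := by
  classical
  have hne : Nat.find h ≠ 0 := fun e => by
    have := Nat.find_spec h
    rw [e] at this
    exact this.not_ge h0
  obtain ⟨j, hj⟩ := Nat.exists_eq_succ_of_ne_zero hne
  refine ⟨j, not_lt.1 (Nat.find_min h (by omega)), ?_⟩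
  have := Nat.find_spec h
  rwa [hj] at this

theorem eq_of_mem_Ico_of_strictMono {t : ℕ → ℝ} (ht : StrictMono t) {s : ℝ} {i j : ℕ}
    (hi : s ∈ Ico (t i) (t (i + 1))) (hj : s ∈ Ico (t j) (t (j + 1))) : i = j := by
  have h1 := ht.lt_iff_lt.1 (hi.1.trans_lt hj.2)
  have h2 := ht.lt_iff_lt.1 (hj.1.trans_lt hi.2)
  omega

/-- A sequence of points off `C` whose distance to `C` vanishes has a subsequence converging to
a boundary point. -/
theorem exists_tendsto_frontier (hCn : C.Nonempty)
    (hCf : IsCompact (frontier C)) {z : ℕ → Euc n} (hz : ∀ j, z j ∉ C)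
    (hd : Tendsto (fun j => Metric.infDist (z j) C) atTop (𝓝 0)) :
    ∃ ζ ∈ frontier C, ∃ φ : ℕ → ℕ, StrictMono φ ∧ Tendsto (z ∘ φ) atTop (𝓝 ζ) := by
  obtain ⟨ζ, -, φ, hφ, hζ⟩ := (hCf.cthickening (r := 1)).tendsto_subseq' (x := z) (by
    refine Eventually.frequently ?_
    filter_upwards [hd.eventually (gt_mem_nhds one_pos)] with j hj
    exact mem_cthickening_frontier hCn (hz j) hj.le)
  refine ⟨ζ, ?_, φ, hφ, hζ⟩
  rw [frontier_eq_closure_inter_closure]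
  constructor
  · have h1 := ((Metric.continuous_infDist_pt C).tendsto ζ).comp hζ
    have h2 := tendsto_nhds_unique h1 (hd.comp hφ.tendsto_atTop)
    exact (Metric.mem_closure_iff_infDist_zero hCn).2 h2
  · exact mem_closure_of_tendsto hζ (Eventually.of_forall fun j => hz _)

/-- Concatenation of a sequence of arcs approaching `C`. -/
theorem exists_concatenation (hCn : C.Nonempty) (hC : IsClosed C)
    (hCf : IsCompact (frontier C)) {M τ b : ℕ → ℝ} {x : ℕ → ℝ → Euc n} {u : ℕ → ℝ → Euc m}
    (harc : ∀ j, IsArc g C U (M j) (τ j) (x j) (u j)) (hτ : ∀ j, 0 < τ j)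
    (hglue : ∀ j, x (j + 1) 0 = x j (τ j)) (hb : Tendsto b atTop (𝓝 0))
    (hxb : ∀ j, ∀ s ∈ Icc 0 (τ j), Metric.infDist (x j s) C ≤ b j) :
    ∃ (T : EReal) (X : ℝ → Euc n) (v : ℝ → Euc m), IsAdmissiblePair g C U T X v ∧
      X 0 = x 0 0 ∧ ∀ s, 0 ≤ s → (∃ j, ∑ i ∈ Finset.range j, τ i ≤ s ∧
        s < ∑ i ∈ Finset.range (j + 1), τ i ∧ X s = x j (s - ∑ i ∈ Finset.range j, τ i) ∧
        v s = u j (s - ∑ i ∈ Finset.range j, τ i)) ∨ (s ∉ timeDomain T ∧ X s ∈ C) := by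
  classical
  set t : ℕ → ℝ := fun j => ∑ i ∈ Finset.range j, τ i with ht
  have ht0 : t 0 = 0 := by simp [ht]
  have hts : ∀ j, t (j + 1) = t j + τ j := fun j => Finset.sum_range_succ _ _
  have htm : StrictMono t := strictMono_nat_of_lt_succ fun j => by linarith [hts j, hτ j]
  have htn : ∀ j, 0 ≤ t j := fun j => ht0 ▸ htm.monotone (Nat.zero_le j)
  have hstart : ∀ j, (0 : ℝ) ∈ Icc 0 (τ j) := fun j => ⟨le_rfl, (hτ j).le⟩
  -- A limit point of the junction states, serving as terminal point if the total duration is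
  -- finite.
  obtain ⟨ζ, hζf, φ, hφ, hζ⟩ := exists_tendsto_frontier hCn hCf (z := fun j => x j 0)
    (fun j => (harc j).traj_mem 0 (hstart j))
    (squeeze_zero (fun j => Metric.infDist_nonneg) (fun j => hxb j 0 (hstart j)) hb)
  set T : EReal := ⨆ j, (t j : EReal) with hT
  have htT : ∀ j, (t j : EReal) < T := fun j =>
    (EReal.coe_lt_coe_iff.2 (htm (Nat.lt_succ_self j))).trans_le
      (le_iSup (fun j => (t j : EReal)) (j + 1))
  have hidx : ∀ s ∈ timeDomain T, ∃ j, s ∈ Ico (t j) (t (j + 1)) := by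
    rintro s ⟨hs0, hsT⟩
    obtain ⟨j, hj⟩ := lt_iSup_iff.1 hsT
    exact exists_mem_Ico_of_lt (ht0.trans_le hs0) ⟨j, by exact_mod_cast hj⟩
  set X : ℝ → Euc n := fun s =>
    if h : ∃ j, s ∈ Ico (t j) (t (j + 1)) then x h.choose (s - t h.choose) else ζ with hX
  set v : ℝ → Euc m := fun s =>
    if h : ∃ j, s ∈ Ico (t j) (t (j + 1)) then u h.choose (s - t h.choose) else u 0 0 with hv
  have hXj : ∀ j, ∀ s ∈ Ico (t j) (t (j + 1)), X s = x j (s - t j) := by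
    intro j s hs
    have h : ∃ j, s ∈ Ico (t j) (t (j + 1)) := ⟨j, hs⟩
    have e := eq_of_mem_Ico_of_strictMono htm h.choose_spec hs
    simp only [hX, dif_pos h]
    rw [e]
  have hvj : ∀ j, ∀ s ∈ Ico (t j) (t (j + 1)), v s = u j (s - t j) := by
    intro j s hs
    have h : ∃ j, s ∈ Ico (t j) (t (j + 1)) := ⟨j, hs⟩
    have e := eq_of_mem_Ico_of_strictMono htm h.choose_spec hs
    simp only [hv, dif_pos h]
    rw [e]
  -- The right endpoint belongs to the next piece; the gluing condition makes both descriptions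
  -- agree there.
  have hXi : ∀ j, ∀ s ∈ Icc (t j) (t (j + 1)), X s = x j (s - t j) := by
    intro j s hs
    rcases eq_or_lt_of_le hs.2 with e | h
    · rw [hXj (j + 1) s ⟨e.ge, e.trans_lt (htm (Nat.lt_succ_self _))⟩, e, sub_self, hglue, hts]
      congr 1
      ring
    · exact hXj j s ⟨hs.1, h⟩
  have hshift : ∀ j, ∀ s ∈ Icc (t j) (t (j + 1)), s - t j ∈ Icc 0 (τ j) := fun j s hs =>
    ⟨by linarith [hs.1], by linarith [hs.2, hts j]⟩
  have hLip : ∀ j, ∃ K, LipschitzOnWith K X (Icc 0 (t j)) := by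
    intro j
    induction j with
    | zero =>
      refine ⟨0, ?_⟩
      rw [ht0, Icc_self]
      exact LipschitzOnWith.of_dist_le_mul fun a ha c hc => by simp_all
    | succ j ih =>
      refine exists_lipschitzOnWith_Icc_union ih ?_
      obtain ⟨K, hK⟩ := (harc j).lipschitz
      refine ⟨K, LipschitzOnWith.of_dist_le_mul fun a ha c hc => ?_⟩
      rw [hXi j a ha, hXi j c hc]
      have := hK.dist_le_mul _ (hshift j a ha) _ (hshift j c hc)
      rwa [dist_sub_right] at this
  have hXC : ∀ j, ∀ s ∈ Ico (t j) (t (j + 1)), X s ∉ C ∧ Metric.infDist (X s) C ≤ b j := by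
    intro j s hs
    have hs' := hshift j s (Ico_subset_Icc_self hs)
    rw [hXj j s hs]
    exact ⟨(harc j).traj_mem _ hs', hxb j _ hs'⟩
  have hout : ∀ s, s ∉ timeDomain T → 0 ≤ s → X s = ζ := by
    intro s hs hs0
    have : ¬ ∃ j, s ∈ Ico (t j) (t (j + 1)) := by
      rintro ⟨j, hj⟩
      exact hs ⟨hs0, (EReal.coe_lt_coe_iff.2 hj.2).trans (htT _)⟩
    simp only [hX, dif_neg this]
  refine ⟨T, X, v, ⟨?_, ?_, ?_, ?_, ?_, ?_, ?_⟩, ?_, ?_⟩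
  · simpa [ht0] using htT 0
  · intro s hs
    obtain ⟨j, hj⟩ := hidx s hs
    rw [hvj j s hj]
    exact (harc j).control_mem _
  · intro c hc
    obtain ⟨N, hN⟩ := hidx c hc
    have hsub : Icc 0 c ⊆ ⋃ j, Ico (t j) (t (j + 1)) := fun s hs =>
      mem_iUnion.2 (hidx s (Icc_subset_timeDomain hc hs))
    have hmeas : AEStronglyMeasurable v (volume.restrict (⋃ j, Ico (t j) (t (j + 1)))) := by
      refine AEStronglyMeasurable.iUnion fun j => ?_
      refine (((harc j).measurable.comp (measurable_id.sub_const (t j))).aestronglyMeasurable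
        (μ := volume.restrict (Ico (t j) (t (j + 1))))).congr ?_
      filter_upwards [ae_restrict_mem measurableSet_Ico] with s hs
      exact (hvj j s hs).symm
    refine memLp_top_of_bound (hmeas.mono_measure (Measure.restrict_mono hsub le_rfl))
      (∑ i ∈ Finset.range (N + 1), |M i|) ?_
    filter_upwards [ae_restrict_mem measurableSet_Icc] with s hs
    obtain ⟨j, hj⟩ := hidx s (Icc_subset_timeDomain hc hs)
    have hjN : j < N + 1 := htm.lt_iff_lt.1 (hj.1.trans_lt (hs.2.trans_lt hN.2))
    rw [hvj j s hj]
    exact (((harc j).control_le _).trans (le_abs_self _)).trans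
      (Finset.single_le_sum (f := fun i => |M i|) (fun i _ => abs_nonneg _)
        (Finset.mem_range.2 hjN))
  · intro s hs
    obtain ⟨j, hj⟩ := hidx s hs
    exact (hXC j s hj).1
  · intro c hc
    obtain ⟨N, hN⟩ := hidx c hc
    obtain ⟨K, hK⟩ := hLip (N + 1)
    refine LipschitzOnWith.absolutelyContinuousOnInterval (K := K) (hK.mono ?_)
    rw [uIcc_of_le hc.1]
    exact Icc_subset_Icc_right hN.2.le
  · have h1 : ∀ᵐ s : ℝ, ∀ j, s - t j ∈ Ioo 0 (τ j) →
        HasDerivAt (x j) (g (x j (s - t j)) (u j (s - t j))) (s - t j) := by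
      rw [ae_all_iff]
      intro j
      exact (measurePreserving_sub_right volume (t j)).quasiMeasurePreserving.ae (harc j).ode
    -- The junction times, where `X` may fail to be differentiable, are countable.
    have h2 : ∀ᵐ s : ℝ, s ∉ range t :=
      measure_eq_zero_iff_ae_notMem.1 ((countable_range t).measure_zero volume)
    have h3 : ∀ᵐ s : ℝ, s ∈ timeDomain T → HasDerivAt X (g (X s) (v s)) s := by
      filter_upwards [h1, h2] with s hs1 hs2 hsT
      obtain ⟨j, hj⟩ := hidx s hsT
      have hlt : t j < s := lt_of_le_of_ne hj.1 fun e => hs2 ⟨j, e⟩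
      have h4 := hs1 j ⟨by linarith, by linarith [hj.2, hts j]⟩
      rw [hXj j s hj, hvj j s hj]
      refine (h4.comp_sub_const s (t j)).congr_of_eventuallyEq ?_
      filter_upwards [Ioo_mem_nhds hlt hj.2] with r hr
      exact hXj j r (Ioo_subset_Ico_self hr)
    have hTm : MeasurableSet (timeDomain T) := by
      have : timeDomain T = Ici 0 ∩ (fun s : ℝ => (s : EReal)) ⁻¹' Iio T := rfl
      rw [this]
      exact measurableSet_Ici.inter (measurable_coe_real_ereal measurableSet_Iio)
    rwa [ae_restrict_iff' hTm]
  · intro S hS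
    have hlt : ∀ j, t j < S := fun j => by
      have := htT j
      rw [hS] at this
      exact_mod_cast this
    have hS0 : 0 ≤ S := (htn 0).trans (hlt 0).le
    have htS : Tendsto t atTop (𝓝 S) := by
      have h1 : Tendsto (fun j => (t j : EReal)) atTop (𝓝 T) :=
        tendsto_atTop_iSup fun i j hij => EReal.coe_le_coe_iff.2 (htm.monotone hij)
      rw [hS] at h1
      exact EReal.tendsto_coe.1 h1
    refine ⟨?_, ζ, ⟨hζf, t ∘ φ, htm.comp hφ, fun i => ⟨htn _, hlt _⟩,
      htS.comp hφ.tendsto_atTop, ?_⟩, ?_⟩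
    · refine Metric.tendsto_nhds.2 fun ε hε => ?_
      obtain ⟨N, hN⟩ := eventually_atTop.1 (hb.eventually (gt_mem_nhds hε))
      filter_upwards [Ioo_mem_nhdsLT (hlt N)] with s hs
      obtain ⟨j, hj⟩ := hidx s ⟨(htn N).trans hs.1.le, by rw [hS]; exact_mod_cast hs.2⟩
      have hNj : N < j + 1 := htm.lt_iff_lt.1 (hs.1.trans hj.2)
      rw [Real.dist_eq, sub_zero, abs_of_nonneg Metric.infDist_nonneg]
      exact (hXC j s hj).2.trans_lt (hN j (by omega))
    · refine hζ.congr fun i => ?_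
      have := hXj (φ i) (t (φ i)) ⟨le_rfl, htm (Nat.lt_succ_self _)⟩
      simp only [Function.comp]
      rw [this, sub_self]
    · intro s hs
      refine hout s (fun h => ?_) (hS0.trans hs)
      have h2 := h.2
      rw [hS, EReal.coe_lt_coe_iff] at h2
      exact h2.not_ge hs
  · rw [hXj 0 0 ⟨ht0.le, by rw [hts, ht0, zero_add]; exact hτ 0⟩, ht0, sub_zero]
  · intro s hs
    by_cases hsT : s ∈ timeDomain T
    · obtain ⟨j, hj⟩ := hidx s hsT
      exact Or.inl ⟨j, hj.1, hj.2, hXj j s hj, hvj j s hj⟩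
    · refine Or.inr ⟨hsT, ?_⟩
      rw [hout s hsT hs]
      exact hC.frontier_subset hζf

/-! ### From descent to a `𝒦ℒ` bound with `U ∩ σ` controls -/

/-- Discrete primitives on `ℤ`. -/
theorem exists_int_primitive (T : ℤ → ℝ) : ∃ P : ℤ → ℝ, ∀ k, P (k + 1) = P k + T k := by
  refine ⟨fun k => ∑ i ∈ Finset.Ico 0 k, T i - ∑ i ∈ Finset.Ico k 0, T i, fun k => ?_⟩
  beta_reduce
  rcases le_or_gt 0 k with hk | hk
  · have e1 : Finset.Ico 0 (k + 1) = insert k (Finset.Ico 0 k) := by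
      ext i; simp only [Finset.mem_Ico, Finset.mem_insert]; omega
    rw [e1, Finset.sum_insert (by simp), Finset.Ico_eq_empty (show ¬k < 0 by omega),
      Finset.Ico_eq_empty (show ¬k + 1 < 0 by omega)]
    simp
    ring
  · have e1 : Finset.Ico k 0 = insert k (Finset.Ico (k + 1) 0) := by
      ext i; simp only [Finset.mem_Ico, Finset.mem_insert]; omega
    rw [e1, Finset.sum_insert (by simp), Finset.Ico_eq_empty (show ¬0 < k by omega),
      Finset.Ico_eq_empty (show ¬0 < k + 1 by omega)]
    simp

/-- Let `P` be a primitive of the durations. Starting in shell `k`, phase `l ≤ k` is over by time `P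
(k + 1) - P l`, so `exp (P l) ≤ exp (P (k + 1)) * exp (-s)` at any time `s` of that phase. Majorants
with `b l ≤ α (exp (P l))` and `exp (P (k + 1)) ≤ γ (2 ^ k)` turn this into the bound `α (γ r * exp
(-s))`, where `r` is the initial distance. -/
theorem HasDescent.isGACSigma (hCn : C.Nonempty) (hC : IsClosed C) (hCf : IsCompact (frontier C))
    (h : HasDescent g C U) : IsGACSigma g C U := by
  obtain ⟨b, T, M, hbm, hb0, h⟩ := h
  obtain ⟨σ, hσc, hσ0, hσ⟩ := exists_continuousOn_ge_of_Icc (M := M) hb0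
  -- Increments of at least `1` force `P` to tend to `±∞` at `±∞`, which both majorants require.
  obtain ⟨P, hP⟩ := exists_int_primitive fun k => max 1 (T k)
  have hP1 : ∀ k, P k + 1 ≤ P (k + 1) := fun k => by rw [hP]; gcongr; exact le_max_left _ _
  have hPT : ∀ k, P k + T k ≤ P (k + 1) := fun k => by rw [hP]; gcongr; exact le_max_right _ _
  have hPm : StrictMono P := strictMono_int_of_lt_succ fun k => by linarith [hP1 k]
  have hPk : Monotone fun k : ℤ => P k - k := monotone_int_of_le_succ fun k => by
    push_cast
    linarith [hP1 k]
  have hPtop : Tendsto P atTop atTop := by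
    refine tendsto_atTop_mono' atTop ?_ (tendsto_atTop_add_const_left _ (P 0)
      (tendsto_intCast_atTop_atTop (R := ℝ)))
    filter_upwards [eventually_ge_atTop 0] with k hk
    have := hPk hk
    simp only [Int.cast_zero] at this
    linarith
  have hPbot : Tendsto P atBot atBot := by
    refine tendsto_atBot_mono' atBot ?_ (tendsto_atBot_add_const_left _ (P 0)
      (tendsto_intCast_atBot_iff.2 tendsto_id))
    filter_upwards [eventually_le_atBot 0] with k hk
    have := hPk hk
    simp only [Int.cast_zero] at this
    simp only [id]
    linarith
  have hbn : ∀ k, 0 ≤ b k := fun k => hbm.le_of_tendsto hb0 k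
  obtain ⟨α, hα, hαb⟩ := exists_isKInf_ge_seq (a := fun k => Real.exp (P k)) (c := b)
    (Real.exp_strictMono.comp hPm) (fun k => Real.exp_pos _)
    (Real.tendsto_exp_atTop.comp hPtop) hbm hbn hb0
  have h2top : Tendsto (fun k : ℤ => (2 : ℝ) ^ k) atTop atTop :=
    tendsto_atTop_atTop_of_monotone (zpow_right_strictMono₀ one_lt_two).monotone fun B => by
      obtain ⟨N, hN⟩ := pow_unbounded_of_one_lt B (one_lt_two (α := ℝ))
      exact ⟨N, by simpa using hN.le⟩
  obtain ⟨γ, hγ, hγP⟩ := exists_isKInf_ge_seq (a := fun k : ℤ => (2 : ℝ) ^ k)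
    (c := fun k => Real.exp (P (k + 1)))
    (zpow_right_strictMono₀ one_lt_two) (fun k => zpow_pos (by norm_num) k) h2top
    (fun k l hkl => Real.exp_le_exp.2 (hPm.monotone (by linarith)))
    (fun k => (Real.exp_pos _).le)
    (Real.tendsto_exp_atBot.comp (hPbot.comp (tendsto_atBot_add_const_right _ 1 tendsto_id)))
  have hβ := isKL_of_isKInf hα hγ
  refine ⟨σ, hσc, hσ0, _, hβ, fun z hz => ?_⟩
  have hz0 : 0 < Metric.infDist z C := (hC.notMem_iff_infDist_pos hCn).1 hz
  obtain ⟨k, hk1, hk2⟩ := exists_mem_Ioc_zpow hz0 one_lt_two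
  -- The choice is made total, with junk data off the shell, so that the successive starting states
  -- `Z` can be defined by plain recursion.
  have hstep : ∀ (l : ℤ) (y : Euc n), ∃ (τ : ℝ) (x : ℝ → Euc n) (u : ℝ → Euc m),
      (2 : ℝ) ^ l < Metric.infDist y C → Metric.infDist y C ≤ (2 : ℝ) ^ (l + 1) →
      IsArc g C U (M l) τ x u ∧ 0 < τ ∧ τ ≤ T l ∧
        x 0 = y ∧ Metric.infDist (x τ) C = (2 : ℝ) ^ l ∧
        ∀ t ∈ Icc 0 τ, (2 : ℝ) ^ l ≤ Metric.infDist (x t) C ∧ Metric.infDist (x t) C ≤ b l := by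
    intro l y
    by_cases hy : (2 : ℝ) ^ l < Metric.infDist y C ∧ Metric.infDist y C ≤ (2 : ℝ) ^ (l + 1)
    · obtain ⟨τ, x, u, hx⟩ := h l y hy.1 hy.2
      exact ⟨τ, x, u, fun _ _ => hx⟩
    · exact ⟨0, 0, 0, fun h1 h2 => absurd ⟨h1, h2⟩ hy⟩
  choose τ x u hxu using hstep
  let Z : ℕ → Euc n := fun j =>
    Nat.rec z (fun j y => x (k - j) y (τ (k - j) y)) j
  have hZs : ∀ j : ℕ, Z (j + 1) = x (k - j) (Z j) (τ (k - j) (Z j)) := fun j => rfl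
  have hZ : ∀ j : ℕ, (2 : ℝ) ^ (k - j) < Metric.infDist (Z j) C ∧
      Metric.infDist (Z j) C ≤ (2 : ℝ) ^ (k - j + 1) := by
    intro j
    induction j with
    | zero => simpa [Z] using ⟨hk1, hk2⟩
    | succ j ih =>
      rw [hZs, (hxu _ _ ih.1 ih.2).2.2.2.2.1]
      push_cast
      refine ⟨zpow_lt_zpow_right₀ one_lt_two (by linarith), le_of_eq ?_⟩
      congr 1
      ring
  have hp := fun j : ℕ => hxu (k - j) (Z j) (hZ j).1 (hZ j).2
  have hkbot : Tendsto (fun j : ℕ => k - (j : ℤ)) atTop atBot := by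
    simp only [sub_eq_add_neg]
    exact tendsto_atBot_add_const_left _ k
      (tendsto_neg_atTop_atBot.comp tendsto_natCast_atTop_atTop)
  obtain ⟨S, X, v, hadm, hX0, hX⟩ := exists_concatenation (g := g) (U := U) hCn hC hCf
    (M := fun j => M (k - j)) (τ := fun j => τ (k - j) (Z j)) (b := fun j => b (k - j))
    (x := fun j => x (k - j) (Z j)) (u := fun j => u (k - j) (Z j))
    (fun j => (hp j).1) (fun j => (hp j).2.1)
    (fun j => by rw [(hp (j + 1)).2.2.2.1, hZs]) (hb0.comp hkbot)
    (fun j s hs => ((hp j).2.2.2.2.2 s hs).2)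
  have htime : ∀ j : ℕ, ∑ i ∈ Finset.range j, τ (k - i) (Z i) ≤ P (k + 1) - P (k + 1 - j) := by
    intro j
    induction j with
    | zero => simp
    | succ j ih =>
      rw [Finset.sum_range_succ]
      have h1 := hPT (k - j)
      have h2 := (hp j).2.2.1
      have e1 : k + 1 - (j : ℤ) = k - j + 1 := by ring
      have e2 : k + 1 - ((j + 1 : ℕ) : ℤ) = k - j := by push_cast; ring
      rw [e1] at ih
      rw [e2]
      linarith
  have hmem : ∀ (j : ℕ) (s : ℝ), ∑ i ∈ Finset.range j, τ (k - i) (Z i) ≤ s →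
      s < ∑ i ∈ Finset.range (j + 1), τ (k - i) (Z i) →
      s - ∑ i ∈ Finset.range j, τ (k - i) (Z i) ∈ Icc 0 (τ (k - j) (Z j)) := by
    intro j s h1 h2
    rw [Finset.sum_range_succ] at h2
    exact ⟨by linarith, by linarith⟩
  refine ⟨S, X, v, hadm, ?_, fun s hs => ?_, ?_⟩
  · exact hX0.trans (hp 0).2.2.2.1
  · rcases hX s hs with ⟨j, h1, h2, h3, -⟩ | ⟨-, h3⟩
    · rw [h3]
      refine ((hp j).2.2.2.2.2 _ (hmem j s h1 h2)).2.trans ((hαb (k - j)).trans ?_)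
      refine hα.strictMonoOn.monotoneOn (Real.exp_pos _).le
        (mul_nonneg (hγ.nonneg hz0.le) (Real.exp_pos _).le) ?_
      have e1 : Real.exp (P (k + 1)) ≤ γ (Metric.infDist z C) :=
        (hγP k).trans (hγ.strictMonoOn.monotoneOn (zpow_pos (two_pos (α := ℝ)) k).le hz0.le hk1.le)
      refine le_trans ?_ (mul_le_mul_of_nonneg_right e1 (Real.exp_pos _).le)
      rw [← Real.exp_add]
      refine Real.exp_le_exp.2 ?_
      -- The time bound is taken at the end of phase `j`, since `s` precedes it.
      have e2 := htime (j + 1)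
      have e3 : k + 1 - ((j + 1 : ℕ) : ℤ) = k - j := by push_cast; ring
      rw [e3] at e2
      linarith
    · rw [Metric.infDist_zero_of_mem h3]
      exact hβ.nonneg _ _ Metric.infDist_nonneg hs
  · have hTm : MeasurableSet (timeDomain S) :=
      measurableSet_Ici.inter (measurable_coe_real_ereal measurableSet_Iio)
    filter_upwards [ae_restrict_mem hTm] with s hs
    rcases hX s hs.1 with ⟨j, h1, h2, h3, h4⟩ | ⟨h3, -⟩
    · rw [h3, h4]
      obtain ⟨h5, h6⟩ := (hp j).2.2.2.2.2 _ (hmem j s h1 h2)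
      exact ((hp j).1.control_le _).trans (hσ _ _ h5 h6)
    · exact absurd hs h3

theorem IsGACSigma.isGAC (h : IsGACSigma g C U) : IsGAC g C U := by
  obtain ⟨σ, -, -, β, hβ, h⟩ := h
  refine ⟨β, hβ, fun z hz => ?_⟩
  obtain ⟨T, x, u, h1, h2, h3, -⟩ := h z hz
  exact ⟨T, x, u, h1, h2, h3⟩

theorem tfae_isGAC (hCn : C.Nonempty) (hC : IsClosed C) (hCf : IsCompact (frontier C))
    (hU : IsClosed U) (hl : LocallyLipschitzInState g C U) :
    [IsGAC g C U, HasDescent g C U, IsGACSigma g C U].TFAE := by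
  tfae_have 1 → 2 := IsGAC.hasDescent hCn hC hCf hU hl
  tfae_have 2 → 3 := HasDescent.isGACSigma hCn hC hCf
  tfae_have 3 → 1 := IsGACSigma.isGAC
  tfae_finish

end ControlGAC

end

theorem theorem3p2 {n m : ℕ} (C : Set (ControlGAC.Euc n)) (U : Set (ControlGAC.Euc m))
    (f : ControlGAC.Euc n → ControlGAC.Euc m → ControlGAC.Euc n) (ν : ℝ → ℝ)
    (hC_nonempty : C.Nonempty) (hC_closed : IsClosed C) (hC_frontier : IsCompact (frontier C))
    (hU : ControlGAC.IsClosedCone U)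
    (hl : ControlGAC.LocallyLipschitzInState f C U)
    (hν : ControlGAC.IsGrowthRate ν) (hg : ControlGAC.HasGrowth ν f C U) :
    (ControlGAC.IsGAC f C U ↔ ControlGAC.IsGAC (ControlGAC.rescaled ν f) C U) ∧
    (ControlGAC.IsGAC f C U ↔ ControlGAC.IsGACSigma f C U) ∧
    (ControlGAC.IsGAC (ControlGAC.rescaled ν f) C U ↔
      ControlGAC.IsGACSigma (ControlGAC.rescaled ν f) C U) := by
  have h1 := ControlGAC.tfae_isGAC hC_nonempty hC_closed hC_frontier hU.isClosed hl
  have h2 := ControlGAC.tfae_isGAC hC_nonempty hC_closed hC_frontier hU.isClosed (hl.rescaled hν)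
  refine ⟨?_, h1.out 0 2, h2.out 0 2⟩
  exact (h1.out 0 1).trans ((ControlGAC.hasDescent_rescaled_iff hν).symm.trans (h2.out 1 0))
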